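/- **Setting.** Let $d\ge 1$ and $K\ge 0$ be integers with $K^2<d$. Let $A=U^\top D U$, where $U$ is a Haar-random $d\times d$ orthogonal matrix and $D$ is a (possibly random) real diagonal matrix independent of $U$. Let $z_1,\dots,z_K$ be i.i.d. standard Gaussian vectors in $\mathbb R^d$, independent of $(U,D)$. For $k\ge 0$ put $H_k=\{(i,j): i\ge 0,\ 1\le j\le k,\ i+j\le k+1\}$. An *adaptive deterministic algorithm* making $K$ extended-oracle queries is a collection of measurable functions $v_1,v_2(\cdot),\dots,v_K(\cdot)$ with values in $\mathbb R^d$, where $v_k$ takes as input a family of vectors of $\mathbb R^d$ indexed by $H_{k-1}$ (so $v_1$ is a constant vector). Its queries on $A$ are defined recursively by $v_k^{\mathrm{alg}}=v_k(\{A^i v_j^{\mathrm{alg}}\}_{(i,j)\in H_{k-1}})$ for $1\le k\le K$. **Lemma (reduction to block Krylov).** For every adaptive deterministic algorithm making $K$ extended-oracle queries in $\mathbb R^d$ there are measurable functions of families of vectors $\{x_{i,j}\}_{i\ge 0,\,j\ge 1,\,i+j\le k}$, $k=1,\dots,K$, one with values in $\mathbb R^d$ and one with values in the rotation group $SO(d)$,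 which depend only on $d$, $K$ and the algorithm (not on the law of $D$), such that the vectors $\tilde v_k$ and rotation matrices $\tilde U_k$ obtained by applying them to the block Krylov data $\{A^i z_j\}_{i\ge 0,\,j\ge 1,\,i+j\le k}$ have the following properties. 1. $\tilde v_k$ and $\tilde U_k$ depend only on $\{A^i z_j\}_{i+j\le k}$, and $\tilde v_k\in\operatorname{Span}(\{A^i z_j\}_{i+j\le k})$. If the query $v_k^{\mathrm{alg}}$ is almost surely a unit vector, then so is $\tilde v_k$. 2. With $\tilde U_{1:K}=\tilde U_1\tilde U_2\cdots\tilde U_K$, $$\Big(\tilde U_{1:K}^\top A\,\tilde U_{1:K},\ \{\tilde U_{1:K}^\top A^i\tilde v_j\}_{(i,j)\in H_K}\Big)\ \overset{d}{=}\ \Big(A,\ \{A^i v_j^{\mathrm{alg}}\}_{(i,j)\in H_K}\Big),$$ as joint distributions, over the randomness of $A$ and $z_1,\dots,z_K$. -/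

import Mathlib

open MeasureTheory ProbabilityTheory

namespace BlockKrylov

/-- The Euclidean space `ℝ^d`. -/
abbrev E (d : ℕ) : Type := EuclideanSpace ℝ (Fin d)

/-- The product of a `d × d` matrix with a vector of `ℝ^d`. -/
noncomputable def mulv {d : ℕ} (A : Matrix (Fin d) (Fin d) ℝ) (x : E d) : E d :=
  Matrix.toEuclideanLin A x

section Measurability

/-- The entrywise (product) σ-algebra on matrices. -/
instance instMeasurableSpaceMatrix {d : ℕ} : MeasurableSpace (Matrix (Fin d) (Fin d) ℝ) :=
  inferInstanceAs (MeasurableSpace (Fin d → Fin d → ℝ))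

/-- The entrywise σ-algebra on matrices is the Borel σ-algebra. -/
instance instBorelSpaceMatrix {d : ℕ} : BorelSpace (Matrix (Fin d) (Fin d) ℝ) :=
  inferInstanceAs (BorelSpace (Fin d → Fin d → ℝ))

end Measurability

/-- A random orthogonal matrix is Haar-random if its law is a Haar measure on the compact group
`O(d)`. (On a probability space, the law is then the unique Haar probability measure.) -/
def IsHaarRandom {Ω : Type*} [MeasurableSpace Ω] {d : ℕ}
    (U : Ω → Matrix.orthogonalGroup (Fin d) ℝ) (μ : Measure Ω) : Prop :=
  Measurable U ∧ (μ.map U).IsHaarMeasure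

/-- The random matrix `A = Uᵀ D U`, where `D` is the diagonal matrix with diagonal `D`. -/
noncomputable def conjDiag {d : ℕ} (U : Matrix.orthogonalGroup (Fin d) ℝ) (D : Fin d → ℝ) :
    Matrix (Fin d) (Fin d) ℝ :=
  (U : Matrix (Fin d) (Fin d) ℝ).transpose * Matrix.diagonal D * (U : Matrix (Fin d) (Fin d) ℝ)

/-- The index set of the information `A^i v_j` that is available after `k` extended-oracle queries.
Queries are numbered from `0` here, so that the pair `(i, j)` stands for the vector `A^i v_{j+1}`
in the numbering from `1`; there, the condition reads `i + j ≤ k + 1`, `i ≥ 0`, `1 ≤ j ≤ k`. -/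
def oracleIdx (k : ℕ) : Set (ℕ × ℕ) := {p | p.1 + p.2 ≤ k ∧ p.2 < k}

/-- The index set of the block Krylov data `A^i z_j` that the simulator may use at its `k`-th step
(steps numbered from `0`). In the numbering from `1` of both the steps and the vectors, the
condition reads `i + j ≤ k`, `i ≥ 0`, `j ≥ 1`. -/
def krylovIdx (k : ℕ) : Set (ℕ × ℕ) := {p | p.1 + p.2 ≤ k}

/-- An adaptive deterministic algorithm that makes `K` extended-oracle queries in `ℝ^d`: the query
number `k` (from `0`) is a measurable function of the information available after the first `k`
queries. For `k = 0` there is no information, and the first query is a constant vector. -/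
structure AdaptiveAlgorithm (d K : ℕ) where
  query : (k : Fin K) → (oracleIdx k → E d) → E d
  measurable_query : ∀ k, Measurable (query k)

/-- The `k`-th query `v_k^alg` that the algorithm makes on input `A`, defined recursively by
`v_k^alg = v_k ({A^i v_j^alg})`. -/
noncomputable def AdaptiveAlgorithm.run {d K : ℕ} (alg : AdaptiveAlgorithm d K)
    (A : Matrix (Fin d) (Fin d) ℝ) (k : Fin K) : E d :=
  alg.query k fun p => mulv (A ^ p.1.1) (alg.run A ⟨p.1.2, p.2.2.trans k.2⟩)
termination_by k.val
decreasing_by exact p.2.2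

/-- The family `{A^i v_j}` over all `(i, j)` in the index set of the information available after
`K` queries `v_j`. -/
noncomputable def oracleInfo {d K : ℕ} (A : Matrix (Fin d) (Fin d) ℝ) (v : Fin K → E d) :
    oracleIdx K → E d :=
  fun p => mulv (A ^ p.1.1) (v ⟨p.1.2, p.2.2⟩)

/-- The block Krylov data `{A^i z_j}` available at step `k < K`. -/
noncomputable def krylovData {d K : ℕ} (A : Matrix (Fin d) (Fin d) ℝ) (z : Fin K → E d)
    (k : Fin K) : krylovIdx k → E d :=
  fun p => mulv (A ^ p.1.1) (z ⟨p.1.2, ((Nat.le_add_left _ _).trans p.2).trans_lt k.2⟩)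

/-- The ordered product `R_1 R_2 ⋯ R_K` of rotation matrices, as a matrix. -/
def rotProd {d K : ℕ} (R : Fin K → Matrix.specialOrthogonalGroup (Fin d) ℝ) :
    Matrix (Fin d) (Fin d) ℝ :=
  ((List.ofFn R).prod : Matrix.specialOrthogonalGroup (Fin d) ℝ)

end BlockKrylov

open BlockKrylov

/-! The law `ν` of `A` is invariant under conjugation by `O(d)`, because Haar measure on a compact
group is right invariant. The heart of the matter is a stronger statement: given the information `I`
from the first `k` queries, the law of `A` is still invariant under conjugation by the stabilizer of
`I`. Conjugating by such a `g` changes none of the first `k` answers, nor the next query, since that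
is a function of `I` (`queryVec_orthConj`). Hence an orthogonal matrix that fixes `I`, and is chosen
from `I` and independent noise only, can conjugate `A` without changing its law
(`map_orthConj_info`).

The simulation maintains an accumulated rotation `R` and the rotated matrix `B = Rᵀ A R`, of law
`ν`. Let `w` be the next query of the algorithm on `B` and `ζ = Rᵀ z_k`, which is a standard
Gaussian independent of `B`. A plane rotation `T` turns the component of `w` orthogonal to `I` into
the direction of the corresponding component of `ζ`, and fixes `I`. The simulated query is `R T w`.
As `T w` lies in the span of `I` and `ζ`, the vector `R T w` lies in the block Krylov space of `A`.
Passing to `R T` turns `B` into `Tᵀ B T`, which has the same law and the same first `k + 1` queries;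
and `(R T)ᵀ` takes the simulated query back to `w`. This gives, pointwise on generic noise, that the
rotated simulated queries are the queries of the algorithm on `B` (`mulv_transpose_simVec`).

The construction fails only if the new direction of `ζ` is proportional to that of `w`. This
confines `ζ` to a subspace of dimension at most `k(k+1) + 1 ≤ K² < d`, a Gaussian null set
(`ae_isGeneric`). Genericity and the law of `B` are propagated together in
`ae_isGenericBefore_and_map_rotatedMat`.

Conditional laws are never formed: invariance given a statistic is expressed by resampling with the
Haar measure of its stabilizer (`IsStabilizerAveraged`). -/

namespace BlockKrylov

set_option linter.unusedSectionVars false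

open Filter Topology
open scoped ENNReal NNReal RealInnerProductSpace

/-! ### Haar measures of stabilizers as a Markov kernel. -/

section StabilizerHaar

variable {G : Type*} [Group G] [TopologicalSpace G] [IsTopologicalGroup G] [CompactSpace G]
  [SecondCountableTopology G] [MeasurableSpace G] [BorelSpace G]

/-- A Haar probability measure on a compact group is right invariant. -/
theorem isMulRightInvariant_of_isHaarMeasure (m : Measure G) [m.IsHaarMeasure]
    [IsProbabilityMeasure m] : m.IsMulRightInvariant := by
  refine ⟨fun g => ?_⟩
  have : IsProbabilityMeasure (m.map (· * g)) :=
    Measure.isProbabilityMeasure_map (by fun_prop)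
  exact Measure.isHaarMeasure_eq_of_isProbabilityMeasure _ _

/-- A compact group carries a left and right invariant probability measure. -/
theorem exists_isHaarMeasure_isProbabilityMeasure :
    ∃ m : Measure G, m.IsHaarMeasure ∧ IsProbabilityMeasure m ∧ m.IsMulRightInvariant := by
  let K₀ : TopologicalSpace.PositiveCompacts G := ⊤
  have h : IsProbabilityMeasure (Measure.haarMeasure K₀) := by
    refine ⟨?_⟩
    simpa [K₀] using Measure.haarMeasure_self (K₀ := K₀)
  exact ⟨_, inferInstance, h, isMulRightInvariant_of_isHaarMeasure _⟩

variable {Y : Type*} [MulAction G Y]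

/-- `θ` is the Haar probability measure of the stabilizer of `y`, seen as a measure on `G`. -/
structure IsStabilizerHaar (y : Y) (θ : Measure G) : Prop where
  prob : IsProbabilityMeasure θ
  fixes : ∀ᵐ g ∂θ, g • y = y
  left_inv : ∀ s : G, s • y = y → θ.map (s * ·) = θ
  right_inv : ∀ s : G, s • y = y → θ.map (· * s) = θ

theorem IsStabilizerHaar.lintegral_mul_left {y : Y} {θ : Measure G} (h : IsStabilizerHaar y θ)
    {s : G} (hs : s • y = y) {f : G → ℝ≥0∞} (hf : Measurable f) :
    ∫⁻ g, f (s * g) ∂θ = ∫⁻ g, f g ∂θ := by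
  conv_rhs => rw [← h.left_inv s hs]
  rw [lintegral_map hf (by fun_prop)]

theorem IsStabilizerHaar.lintegral_mul_right {y : Y} {θ : Measure G} (h : IsStabilizerHaar y θ)
    {s : G} (hs : s • y = y) {f : G → ℝ≥0∞} (hf : Measurable f) :
    ∫⁻ g, f (g * s) ∂θ = ∫⁻ g, f g ∂θ := by
  conv_rhs => rw [← h.right_inv s hs]
  rw [lintegral_map hf (by fun_prop)]

/-- The double integral of `f (a * b)` collapses to either measure, by left invariance of one and
right invariance of the other. Uniqueness makes the choice in `stabilizerHaar` harmless and
identifies its value at `g • y` with a conjugate. -/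
theorem IsStabilizerHaar.eq {y : Y} {θ θ' : Measure G} (h : IsStabilizerHaar y θ)
    (h' : IsStabilizerHaar y θ') : θ = θ' := by
  have := h.prob
  have := h'.prob
  ext s hs
  rw [← lintegral_indicator_one hs, ← lintegral_indicator_one hs]
  set f : G → ℝ≥0∞ := s.indicator 1
  have hf : Measurable f := measurable_one.indicator hs
  calc ∫⁻ g, f g ∂θ = ∫⁻ a, ∫⁻ b, f (a * b) ∂θ ∂θ' := by
        rw [lintegral_congr_ae (h'.fixes.mono fun a ha => h.lintegral_mul_left ha hf)]
        simp
    _ = ∫⁻ b, ∫⁻ a, f (a * b) ∂θ' ∂θ := by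
        rw [lintegral_lintegral_swap]
        exact (hf.comp measurable_mul).aemeasurable
    _ = ∫⁻ g, f g ∂θ' := by
        rw [lintegral_congr_ae (h.fixes.mono fun b hb => h'.lintegral_mul_right hb hf)]
        simp

theorem IsStabilizerHaar.conj {y : Y} {θ : Measure G} (h : IsStabilizerHaar y θ) (g : G) :
    IsStabilizerHaar (g • y) (θ.map fun s => g * s * g⁻¹) := by
  have := h.prob
  have hm : Measurable fun s : G => g * s * g⁻¹ := by fun_prop
  refine ⟨Measure.isProbabilityMeasure_map hm.aemeasurable, ?_, fun s hs => ?_, fun s hs => ?_⟩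
  · have hm' : MeasurableEmbedding fun s : G => g * s * g⁻¹ :=
      ((Homeomorph.mulLeft g).trans (Homeomorph.mulRight g⁻¹)).measurableEmbedding
    rw [hm'.ae_map_iff]
    filter_upwards [h.fixes] with s hs
    rw [mul_smul, mul_smul, inv_smul_smul, hs]
  · have hs' : (g⁻¹ * s * g) • y = y := by
      rw [mul_smul, mul_smul, hs, inv_smul_smul]
    conv_rhs => rw [← h.left_inv _ hs']
    rw [Measure.map_map (by fun_prop) hm, Measure.map_map hm (by fun_prop)]
    congr 1; ext t; simp [mul_assoc]
  · have hs' : (g⁻¹ * s * g) • y = y := by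
      rw [mul_smul, mul_smul, hs, inv_smul_smul]
    conv_rhs => rw [← h.right_inv _ hs']
    rw [Measure.map_map (by fun_prop) hm, Measure.map_map hm (by fun_prop)]
    congr 1; ext t; simp [mul_assoc]

variable [MetricSpace Y] [IsIsometricSMul G Y] [ContinuousSMul G Y]

/-- The stabilizer is closed in a compact group, hence compact; its Haar probability measure is
pushed forward to `G`. -/
theorem exists_isStabilizerHaar (y : Y) : ∃ θ : Measure G, IsStabilizerHaar y θ := by
  have hc : IsClosed (MulAction.stabilizer G y : Set G) :=
    isClosed_eq (continuous_id.smul continuous_const) continuous_const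
  have : CompactSpace (MulAction.stabilizer G y) := isCompact_iff_compactSpace.1 hc.isCompact
  have : SecondCountableTopology (MulAction.stabilizer G y) :=
    TopologicalSpace.Subtype.secondCountableTopology _
  obtain ⟨m, hm, hp, hr⟩ := exists_isHaarMeasure_isProbabilityMeasure
    (G := MulAction.stabilizer G y)
  have hv : Measurable (Subtype.val : MulAction.stabilizer G y → G) := measurable_subtype_coe
  refine ⟨m.map Subtype.val, Measure.isProbabilityMeasure_map hv.aemeasurable, ?_,
    fun s hs => ?_, fun s hs => ?_⟩
  · exact (ae_map_iff hv.aemeasurable (p := fun g => g • y = y) hc.measurableSet).2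
      (Eventually.of_forall fun g => g.2)
  · conv_rhs => rw [← map_mul_left_eq_self m ⟨s, hs⟩]
    rw [Measure.map_map (by fun_prop) hv, Measure.map_map hv (by fun_prop)]
    rfl
  · conv_rhs => rw [← map_mul_right_eq_self m ⟨s, hs⟩]
    rw [Measure.map_map (by fun_prop) hv, Measure.map_map hv (by fun_prop)]
    rfl

/-- The Haar probability measure of the stabilizer of `y`, seen as a measure on `G`. -/
noncomputable def stabilizerHaar (y : Y) : Measure G := (exists_isStabilizerHaar y).choose

theorem isStabilizerHaar_stabilizerHaar (y : Y) :
    IsStabilizerHaar y (stabilizerHaar y : Measure G) :=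
  (exists_isStabilizerHaar y).choose_spec

instance (y : Y) : IsProbabilityMeasure (stabilizerHaar y : Measure G) :=
  (isStabilizerHaar_stabilizerHaar y).prob

/-- The Haar average over a small ball around the stabilizer is close to the average over the
stabilizer. -/
theorem tendsto_average_stabilizerHaar (m : Measure G) [m.IsHaarMeasure]
    (f : G → ℝ) (hf : Continuous f) (y : Y) :
    Tendsto (fun n : ℕ => (m.real {g | dist (g • y) y < 1 / ((n : ℝ) + 1)})⁻¹ *
      ∫ g in {g | dist (g • y) y < 1 / ((n : ℝ) + 1)}, f g ∂m) atTop
      (𝓝 (∫ g, f g ∂(stabilizerHaar y : Measure G))) := by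
  set η : Measure G := stabilizerHaar y
  have hη : IsStabilizerHaar y η := isStabilizerHaar_stabilizerHaar y
  set c := ∫ g, f g ∂η
  -- `F` averages `f` over the stabilizer on the left. It is continuous, equals `c` on the
  -- stabilizer, and has the same integral as `f` over each neighbourhood `N n`.
  set F : G → ℝ := fun g => ∫ s, f (s * g) ∂η
  have hbd : ∃ C, ∀ g, ‖f g‖ ≤ C := by
    obtain ⟨C, hC⟩ := (isCompact_range hf).isBounded.exists_norm_le
    exact ⟨C, fun g => hC _ ⟨g, rfl⟩⟩
  obtain ⟨C, hC⟩ := hbd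
  have hF : Continuous F := by
    have := continuous_parametric_integral_of_continuous (μ := η) (f := fun g s : G => f (s * g))
      (by fun_prop) isCompact_univ
    simpa [F] using this
  have hFc : ∀ g, g • y = y → F g = c := by
    intro g hg
    simp only [F, c]
    conv_rhs => rw [← hη.right_inv g hg]
    rw [integral_map (by fun_prop) hf.aestronglyMeasurable]
  have hd : Continuous fun g : G => dist (g • y) y := by fun_prop
  set N : ℕ → Set G := fun n => {g | dist (g • y) y < 1 / ((n : ℝ) + 1)} with hN
  have hNo : ∀ n, IsOpen (N n) := fun n => isOpen_lt hd continuous_const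
  have hpos : ∀ n, 0 < m.real (N n) := by
    intro n
    refine ENNReal.toReal_pos ((hNo n).measure_pos m ⟨1, ?_⟩).ne' (measure_ne_top _ _)
    simp only [hN, Set.mem_ofPred_eq, one_smul, dist_self]
    positivity
  have hint : ∀ n, ∫ g in N n, f g ∂m = ∫ g in N n, F g ∂m := by
    intro n
    -- Since the action is isometric, `N n` is invariant under left multiplication by the
    -- stabilizer.
    have h1 : ∀ s : G, s • y = y → ∫ g in N n, f (s * g) ∂m = ∫ g in N n, f g ∂m := by
      intro s hs
      rw [← integral_indicator (hNo n).measurableSet, ← integral_indicator (hNo n).measurableSet,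
        ← integral_mul_left_eq_self ((N n).indicator f) s]
      congr 1
      ext g
      have : s * g ∈ N n ↔ g ∈ N n := by
        simp only [hN, Set.mem_ofPred_eq]
        have h : dist ((s * g) • y) y = dist (g • y) y := by
          conv_lhs => rw [mul_smul, ← dist_smul s⁻¹, inv_smul_smul, inv_smul_eq_iff.2 hs.symm]
        rw [h]
      simp only [Set.indicator, this]
    have hi : Integrable (Function.uncurry fun g s : G => f (s * g))
        ((m.restrict (N n)).prod η) := by
      refine Integrable.of_bound ?_ C (Eventually.of_forall fun p => hC _)
      exact Continuous.aestronglyMeasurable (by fun_prop)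
    simp only [F]
    rw [integral_integral_swap hi, integral_congr_ae (hη.fixes.mono h1)]
    simp
  have hFi : ∀ n, IntegrableOn F (N n) m := fun n =>
    (hF.integrable_of_hasCompactSupport (HasCompactSupport.of_compactSpace _)).integrableOn
  rw [Metric.tendsto_atTop]
  intro ε hε
  -- The elements where `F` is far from `c` form a compact set disjoint from the stabilizer, so the
  -- displacement of `y` has a positive minimum there.
  have hδ : ∃ δ > 0, ∀ g : G, dist (g • y) y < δ → |F g - c| ≤ ε / 2 := by
    by_cases hne : {g : G | ε / 2 ≤ |F g - c|}.Nonempty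
    · have hcl : IsCompact {g : G | ε / 2 ≤ |F g - c|} :=
        (isClosed_le continuous_const (by fun_prop)).isCompact
      obtain ⟨g₀, hg₀, hmin⟩ := hcl.exists_isMinOn hne hd.continuousOn
      refine ⟨dist (g₀ • y) y, dist_pos.2 fun h => ?_, fun g hg => ?_⟩
      · have : ε / 2 ≤ |F g₀ - c| := hg₀
        rw [hFc _ h, sub_self, abs_zero] at this
        linarith
      · by_contra hcon
        exact absurd (hmin (show g ∈ {g : G | ε / 2 ≤ |F g - c|} from (not_le.1 hcon).le))
          (not_le.2 hg)
    · refine ⟨1, one_pos, fun g _ => ?_⟩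
      by_contra hcon
      exact hne ⟨g, (not_le.1 hcon).le⟩
  obtain ⟨δ, hδ0, hδ⟩ := hδ
  obtain ⟨n₀, hn₀⟩ := exists_nat_one_div_lt hδ0
  refine ⟨n₀, fun n hn => ?_⟩
  have hle : ∀ g ∈ N n, ‖F g - c‖ ≤ ε / 2 := by
    intro g hg
    refine hδ g (lt_trans (lt_of_lt_of_le hg ?_) hn₀)
    exact one_div_le_one_div_of_le (by positivity) (by exact_mod_cast Nat.succ_le_succ hn)
  have key : (m.real (N n))⁻¹ * ∫ g in N n, f g ∂m - c =
      (m.real (N n))⁻¹ * ∫ g in N n, (F g - c) ∂m := by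
    rw [integral_sub (hFi n) (integrable_const c), hint, mul_sub, setIntegral_const, smul_eq_mul,
      ← mul_assoc, inv_mul_cancel₀ (hpos n).ne', one_mul]
  rw [Real.dist_eq, key, abs_mul, abs_of_pos (inv_pos.2 (hpos n))]
  have h2 := norm_setIntegral_le_of_norm_le_const (measure_lt_top m (N n)) hle
  rw [Real.norm_eq_abs] at h2
  calc (m.real (N n))⁻¹ * |∫ g in N n, (F g - c) ∂m|
      ≤ (m.real (N n))⁻¹ * (ε / 2 * m.real (N n)) := by
        have := (inv_pos.2 (hpos n)).le
        gcongr
    _ = ε / 2 := by field_simp [(hpos n).ne']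
    _ < ε := by linarith

variable [SecondCountableTopology Y] [MeasurableSpace Y] [BorelSpace Y]

/-- The stabilizer can jump with `y`, so the integral need not be continuous; it is a pointwise
limit of Haar averages that are jointly measurable in `y`. -/
theorem measurable_integral_stabilizerHaar (f : G → ℝ) (hf : Continuous f) :
    Measurable fun y : Y => ∫ g, f g ∂(stabilizerHaar y : Measure G) := by
  obtain ⟨m, hm, hp, -⟩ := exists_isHaarMeasure_isProbabilityMeasure (G := G)
  refine measurable_of_tendsto_metrizable (f := fun (n : ℕ) (y : Y) =>
    (m.real {g | dist (g • y) y < 1 / ((n : ℝ) + 1)})⁻¹ *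
      ∫ g in {g | dist (g • y) y < 1 / ((n : ℝ) + 1)}, f g ∂m) (fun n => ?_)
    (tendsto_pi_nhds.2 fun y => tendsto_average_stabilizerHaar m f hf y)
  have hS : MeasurableSet {p : Y × G | dist (p.2 • p.1) p.1 < 1 / ((n : ℝ) + 1)} :=
    (isOpen_lt (by fun_prop) continuous_const).measurableSet
  refine Measurable.mul (Measurable.inv ?_) ?_
  · exact (measurable_measure_prodMk_left hS).ennreal_toReal
  · have : StronglyMeasurable fun y : Y => ∫ g, Set.indicator
        {p : Y × G | dist (p.2 • p.1) p.1 < 1 / ((n : ℝ) + 1)} (fun p => f p.2) (y, g) ∂m := by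
      refine StronglyMeasurable.integral_prod_right' (f := Set.indicator _ _) ?_
      exact ((hf.measurable.comp measurable_snd).indicator hS).stronglyMeasurable
    convert this.measurable using 2 with y
    rw [← integral_indicator]
    · rfl
    · exact (isOpen_lt (by fun_prop) continuous_const).measurableSet

variable [HasOuterApproxClosed G]

theorem measurable_stabilizerHaar : Measurable (stabilizerHaar : Y → Measure G) := by
  refine Measurable.measure_of_isPiSystem_of_isProbabilityMeasure
    (by rw [BorelSpace.measurable_eq (α := G), borel_eq_generateFrom_isClosed])
    isPiSystem_isClosed fun F hF => ?_
  have hF : IsClosed F := hF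
  refine measurable_of_tendsto_metrizable (f := fun (n : ℕ) (y : Y) =>
    ∫⁻ g, hF.apprSeq n g ∂(stabilizerHaar y : Measure G)) (fun n => ?_)
    (tendsto_pi_nhds.2 fun y => HasOuterApproxClosed.tendsto_lintegral_apprSeq hF _)
  have h : ∀ y : Y, ∫⁻ g, hF.apprSeq n g ∂(stabilizerHaar y : Measure G) =
      ENNReal.ofReal (∫ g, ((hF.apprSeq n g : ℝ≥0) : ℝ) ∂(stabilizerHaar y : Measure G)) := by
    intro y
    rw [ofReal_integral_eq_lintegral_ofReal]
    · simp
    · refine Integrable.of_bound (Continuous.aestronglyMeasurable (by fun_prop)) 1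
        (Eventually.of_forall fun g => ?_)
      simpa using HasOuterApproxClosed.apprSeq_apply_le_one hF n g
    · exact Eventually.of_forall fun g => NNReal.coe_nonneg _
  simp only [h]
  exact (measurable_integral_stabilizerHaar _ (by fun_prop)).ennreal_ofReal

/-- `stabilizerHaar` as a Markov kernel. -/
noncomputable def stabilizerKernel (G Y : Type*) [Group G] [TopologicalSpace G]
    [IsTopologicalGroup G] [CompactSpace G] [SecondCountableTopology G] [MeasurableSpace G]
    [BorelSpace G] [MulAction G Y] [MetricSpace Y] [IsIsometricSMul G Y] [ContinuousSMul G Y]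
    [SecondCountableTopology Y] [MeasurableSpace Y] [BorelSpace Y] [HasOuterApproxClosed G] :
    Kernel Y G where
  toFun := stabilizerHaar
  measurable' := measurable_stabilizerHaar

instance : IsMarkovKernel (stabilizerKernel G Y) :=
  ⟨fun y => inferInstanceAs (IsProbabilityMeasure (stabilizerHaar y : Measure G))⟩

theorem isStabilizerHaar_stabilizerKernel (y : Y) :
    IsStabilizerHaar y (stabilizerKernel G Y y) := isStabilizerHaar_stabilizerHaar y

end StabilizerHaar

/-! ### Invariance under stabilizers of a statistic, expressed by resampling. -/

section Averaging

variable {G : Type*} [Group G] [TopologicalSpace G] [IsTopologicalGroup G] [CompactSpace G]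
  [SecondCountableTopology G] [MeasurableSpace G] [BorelSpace G] [HasOuterApproxClosed G]
variable {Y : Type*} [MulAction G Y] [MetricSpace Y] [IsIsometricSMul G Y] [ContinuousSMul G Y]
  [SecondCountableTopology Y] [MeasurableSpace Y] [BorelSpace Y]
variable {Y' : Type*} [MulAction G Y'] [MetricSpace Y'] [IsIsometricSMul G Y'] [ContinuousSMul G Y']
  [SecondCountableTopology Y'] [MeasurableSpace Y'] [BorelSpace Y']
variable {X : Type*} [MeasurableSpace X]

/-- Resampling `x` by a Haar-random element of the stabilizer of `S x` preserves the law `ν`. -/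
def IsStabilizerAveraged (ρ : G → X → X) (ν : Measure X) (S : X → Y) : Prop :=
  ∀ f : X → ℝ≥0∞, Measurable f →
    ∫⁻ x, f x ∂ν = ∫⁻ x, ∫⁻ g, f (ρ g x) ∂(stabilizerKernel G Y (S x)) ∂ν

variable {ρ : G → X → X} {ν : Measure X} {S : X → Y}

theorem measurable_lintegral_stabilizerKernel (hρ : Measurable fun p : X × G => ρ p.2 p.1)
    (hS : Measurable S) {f : X → ℝ≥0∞} (hf : Measurable f) :
    Measurable fun x => ∫⁻ g, f (ρ g x) ∂(stabilizerKernel G Y (S x)) :=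
  Measurable.lintegral_kernel_prod_right' (κ := (stabilizerKernel G Y).comap S hS) (hf.comp hρ)

theorem isStabilizerAveraged_of_subsingleton [Subsingleton Y] [Nonempty Y] [SFinite ν]
    (hρ : Measurable fun p : X × G => ρ p.2 p.1) (hν : ∀ g, ν.map (ρ g) = ν) :
    IsStabilizerAveraged ρ ν S := by
  intro f hf
  obtain ⟨y⟩ := ‹Nonempty Y›
  have h : ∀ x, S x = y := fun x => Subsingleton.elim _ _
  simp only [h]
  rw [lintegral_lintegral_swap (f := fun x g => f (ρ g x)) (hf.comp hρ).aemeasurable]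
  have : ∀ g, ∫⁻ x, f (ρ g x) ∂ν = ∫⁻ x, f x ∂ν := by
    intro g
    conv_rhs => rw [← hν g]
    have hg : Measurable (ρ g) := hρ.comp (measurable_id.prodMk measurable_const)
    rw [lintegral_map hf hg]
  simp [this]

/-- Averaging passes to a finer statistic with smaller stabilizers that is a function of the
given one. -/
theorem IsStabilizerAveraged.comp (h : IsStabilizerAveraged ρ ν S)
    (hρ : Measurable fun p : X × G => ρ p.2 p.1)
    (hmul : ∀ g h x, ρ (g * h) x = ρ g (ρ h x)) (hS : Measurable S)
    (hfix : ∀ x g, g • S x = S x → S (ρ g x) = S x) {φ : Y → Y'} (hφ : Measurable φ)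
    (hstab : ∀ x (g : G), g • φ (S x) = φ (S x) → g • S x = S x) :
    IsStabilizerAveraged ρ ν (φ ∘ S) := by
  intro f hf
  rw [h _ (measurable_lintegral_stabilizerKernel hρ (hφ.comp hS) hf), h f hf]
  refine lintegral_congr fun x => ?_
  -- Resampling over the larger stabilizer leaves the statistic unchanged; the further resampling by
  -- `a` in the smaller one is then absorbed by left invariance.
  have h1 : ∀ᵐ g ∂(stabilizerKernel G Y (S x)),
      ∫⁻ a, f (ρ a (ρ g x)) ∂(stabilizerKernel G Y' ((φ ∘ S) (ρ g x))) =
      ∫⁻ a, f (ρ (a * g) x) ∂(stabilizerKernel G Y' (φ (S x))) := by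
    filter_upwards [(isStabilizerHaar_stabilizerKernel (S x)).fixes] with g hg
    simp only [Function.comp, hfix x g hg, hmul]
  have hfx : Measurable fun g => f (ρ g x) :=
    hf.comp (hρ.comp (measurable_const.prodMk measurable_id))
  rw [lintegral_congr_ae h1, lintegral_lintegral_swap
    (f := fun g a => f (ρ (a * g) x))
    (hfx.comp (g := fun g => f (ρ g x)) (measurable_snd.mul measurable_fst)).aemeasurable,
    lintegral_congr_ae ((isStabilizerHaar_stabilizerKernel (φ (S x))).fixes.mono fun a ha =>
      (isStabilizerHaar_stabilizerKernel (S x)).lintegral_mul_left (hstab x a ha) hfx)]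
  simp

/-- Averaging passes to a finer statistic that is equivariant under the stabilizers of the given
one. -/
theorem IsStabilizerAveraged.of_equivariant (h : IsStabilizerAveraged ρ ν S)
    (hρ : Measurable fun p : X × G => ρ p.2 p.1)
    (hmul : ∀ g h x, ρ (g * h) x = ρ g (ρ h x)) {S' : X → Y'} (hS' : Measurable S')
    (heq : ∀ x g, g • S x = S x → S' (ρ g x) = g • S' x)
    (hstab : ∀ x (g : G), g • S' x = S' x → g • S x = S x) :
    IsStabilizerAveraged ρ ν S' := by
  intro f hf
  rw [h _ (measurable_lintegral_stabilizerKernel hρ hS' hf), h f hf]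
  refine lintegral_congr fun x => ?_
  have hfx : Measurable fun g => f (ρ g x) :=
    hf.comp (hρ.comp (measurable_const.prodMk measurable_id))
  -- By equivariance the stabilizer at the moved point is conjugate by `g`, and `(g * a * g⁻¹) * g =
  -- g * a`. The factor `a` now sits on the right and is absorbed by right invariance.
  have h1 : ∀ᵐ g ∂(stabilizerKernel G Y (S x)),
      ∫⁻ a, f (ρ a (ρ g x)) ∂(stabilizerKernel G Y' (S' (ρ g x))) =
      ∫⁻ a, f (ρ (g * a) x) ∂(stabilizerKernel G Y' (S' x)) := by
    filter_upwards [(isStabilizerHaar_stabilizerKernel (S x)).fixes] with g hg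
    rw [heq x g hg, (isStabilizerHaar_stabilizerKernel (g • S' x)).eq
      ((isStabilizerHaar_stabilizerKernel (S' x)).conj g), lintegral_map
      (f := fun a => f (ρ a (ρ g x)))
      (hf.comp (hρ.comp (measurable_const.prodMk measurable_id))) (by fun_prop)]
    refine lintegral_congr fun a => ?_
    rw [← hmul, inv_mul_cancel_right]
  rw [lintegral_congr_ae h1, lintegral_lintegral_swap
    (f := fun g a => f (ρ (g * a) x))
    (hfx.comp (g := fun g => f (ρ g x)) (measurable_fst.mul measurable_snd)).aemeasurable,
    lintegral_congr_ae ((isStabilizerHaar_stabilizerKernel (S' x)).fixes.mono fun a ha =>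
      (isStabilizerHaar_stabilizerKernel (S x)).lintegral_mul_right (hstab x a ha) hfx)]
  simp

/-- Moving `x` by an element of the stabilizer of `S x` that is chosen as a function of `S x`
preserves the law. -/
theorem IsStabilizerAveraged.map_eq (h : IsStabilizerAveraged ρ ν S)
    (hρ : Measurable fun p : X × G => ρ p.2 p.1)
    (hmul : ∀ g h x, ρ (g * h) x = ρ g (ρ h x)) (hS : Measurable S)
    (hfix : ∀ x g, g • S x = S x → S (ρ g x) = S x) {Ψ : Y → G} (hΨ : Measurable Ψ)
    (hΨfix : ∀ x, Ψ (S x) • S x = S x) :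
    ν.map (fun x => ρ (Ψ (S x)) x) = ν := by
  have hT : Measurable fun x => ρ (Ψ (S x)) x :=
    hρ.comp (measurable_id.prodMk (hΨ.comp hS))
  ext s hs
  rw [← lintegral_indicator_one hs, ← lintegral_indicator_one hs]
  have hf : Measurable (s.indicator (1 : X → ℝ≥0∞)) := measurable_one.indicator hs
  generalize s.indicator (1 : X → ℝ≥0∞) = f at hf
  rw [lintegral_map hf hT, h (fun x => f (ρ (Ψ (S x)) x)) (hf.comp hT), h f hf]
  refine lintegral_congr fun x => ?_
  have hfx : Measurable fun g => f (ρ g x) :=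
    hf.comp (hρ.comp (measurable_const.prodMk measurable_id))
  rw [← (isStabilizerHaar_stabilizerKernel (S x)).lintegral_mul_left (hΨfix x) hfx]
  refine lintegral_congr_ae ?_
  filter_upwards [(isStabilizerHaar_stabilizerKernel (S x)).fixes] with g hg
  simp only [hfix x g hg, hmul]

end Averaging

/-! ### Measurable coefficients of orthogonal projections. -/

section ProjectionCoefficients

variable {F : Type*} [NormedAddCommGroup F] [InnerProductSpace ℝ F]

/-- Coefficients of the orthogonal projection of `y` on the span of `x`, by the Gram–Schmidt
recursion. -/
noncomputable def projCoeffFin : (n : ℕ) → (Fin n → F) → F → Fin n → ℝ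
  | 0, _, _ => fun i => i.elim0
  | n + 1, x, y =>
    let s := x (Fin.last n)
    let a := s - ∑ i, projCoeffFin n (fun i => x i.castSucc) s i • x i.castSucc
    let t := ⟪a, y⟫ / ‖a‖ ^ 2
    Fin.snoc (projCoeffFin n (fun i => x i.castSucc) (y - t • s)) t

theorem inner_sub_sum_projCoeffFin (n : ℕ) (x : Fin n → F) (y : F) (j : Fin n) :
    ⟪x j, y - ∑ i, projCoeffFin n x y i • x i⟫ = 0 := by
  induction n generalizing y with
  | zero => exact j.elim0
  | succ n ih =>
    set x' : Fin n → F := fun i => x i.castSucc with hx'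
    set s := x (Fin.last n) with hs
    set a := s - ∑ i, projCoeffFin n x' s i • x' i with ha
    set t := ⟪a, y⟫ / ‖a‖ ^ 2 with ht
    have hr : y - ∑ i, projCoeffFin (n + 1) x y i • x i =
        (y - t • s) - ∑ i, projCoeffFin n x' (y - t • s) i • x' i := by
      rw [Fin.sum_univ_castSucc]
      simp only [projCoeffFin, Fin.snoc_castSucc, Fin.snoc_last]
      simp only [← hx', ← hs]
      abel
    rw [hr]
    have hsum : ∀ (c : Fin n → ℝ) (v : F), (∀ i, ⟪x' i, v⟫ = 0) → ⟪∑ i, c i • x' i, v⟫ = 0 := by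
      intro c v hv
      simp [sum_inner, real_inner_smul_left, hv]
    refine Fin.lastCases ?_ (fun j => ih x' _ j) j
    set r := (y - t • s) - ∑ i, projCoeffFin n x' (y - t • s) i • x' i with hr'
    have hsa : s = a + ∑ i, projCoeffFin n x' s i • x' i := by rw [ha]; abel
    have hax : ∀ c : Fin n → ℝ, ⟪a, ∑ i, c i • x' i⟫ = 0 := fun c => by
      rw [real_inner_comm]; exact hsum c a (ih x' s)
    have has : ⟪a, s⟫ = ‖a‖ ^ 2 := by
      conv_lhs => rw [hsa]
      rw [inner_add_right, hax, add_zero, real_inner_self_eq_norm_sq]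
    rw [← hs]
    conv_lhs => rw [hsa]
    rw [inner_add_left, hsum _ r (ih x' _), add_zero, hr', inner_sub_right, hax, sub_zero,
      inner_sub_right, real_inner_smul_right, has, ht]
    -- If `s` depends linearly on the earlier vectors, then `a = 0` and division by zero gives `t =
    -- 0`. Thus no linear independence is needed.
    by_cases h0 : a = 0
    · simp [h0]
    · field_simp [norm_ne_zero_iff.2 h0]
      ring

variable {ι : Type*} [Fintype ι]

/-- Coefficients of the orthogonal projection of `y` on the span of the family `x`. -/
noncomputable def projCoeff (x : ι → F) (y : F) (i : ι) : ℝ :=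
  projCoeffFin (Fintype.card ι) (fun j => x ((Fintype.equivFin ι).symm j)) y (Fintype.equivFin ι i)

/-- The orthogonal projection of `y` on the span of the family `x`. -/
noncomputable def proj (x : ι → F) (y : F) : F := ∑ i, projCoeff x y i • x i

/-- The component of `y` orthogonal to the span of the family `x`. -/
noncomputable def perp (x : ι → F) (y : F) : F := y - proj x y

theorem proj_add_perp (x : ι → F) (y : F) : proj x y + perp x y = y := by simp [perp]

theorem proj_mem_span (x : ι → F) (y : F) : proj x y ∈ Submodule.span ℝ (Set.range x) :=
  Submodule.sum_mem _ fun i _ => Submodule.smul_mem _ _ (Submodule.subset_span ⟨i, rfl⟩)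

theorem inner_perp (x : ι → F) (y : F) (i : ι) : ⟪x i, perp x y⟫ = 0 := by
  have h := inner_sub_sum_projCoeffFin (Fintype.card ι)
    (fun j => x ((Fintype.equivFin ι).symm j)) y (Fintype.equivFin ι i)
  rw [Equiv.symm_apply_apply] at h
  convert h using 1
  unfold perp proj
  rw [← (Fintype.equivFin ι).symm.sum_comp]
  simp [projCoeff]

theorem inner_perp_of_mem_span {x : ι → F} {v : F} (hv : v ∈ Submodule.span ℝ (Set.range x))
    (y : F) : ⟪v, perp x y⟫ = 0 := by
  induction hv using Submodule.span_induction with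
  | mem v hv => obtain ⟨i, rfl⟩ := hv; exact inner_perp x y i
  | zero => simp
  | add a b _ _ ha hb => rw [inner_add_left, ha, hb, add_zero]
  | smul c a _ ha => rw [real_inner_smul_left, ha, mul_zero]

theorem proj_eq_self {x : ι → F} {y : F} (hy : y ∈ Submodule.span ℝ (Set.range x)) :
    proj x y = y := by
  have h : perp x y ∈ Submodule.span ℝ (Set.range x) := Submodule.sub_mem _ hy (proj_mem_span x y)
  have := inner_perp_of_mem_span h y
  rw [inner_self_eq_zero] at this
  conv_rhs => rw [← proj_add_perp x y, this, add_zero]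

variable [MeasurableSpace F] [BorelSpace F] [SecondCountableTopology F]

theorem measurable_projCoeffFin (n : ℕ) (i : Fin n) :
    Measurable fun p : (Fin n → F) × F => projCoeffFin n p.1 p.2 i := by
  induction n with
  | zero => exact i.elim0
  | succ n ih =>
    have hx : Measurable fun p : (Fin (n + 1) → F) × F => fun i : Fin n => p.1 i.castSucc := by
      fun_prop
    have hs : Measurable fun p : (Fin (n + 1) → F) × F => p.1 (Fin.last n) := by fun_prop
    have ha : Measurable fun p : (Fin (n + 1) → F) × F => p.1 (Fin.last n) -
        ∑ i, projCoeffFin n (fun i => p.1 i.castSucc) (p.1 (Fin.last n)) i • p.1 i.castSucc := by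
      refine hs.sub (Finset.measurable_fun_sum _ fun i _ => ?_)
      exact ((ih i).comp (hx.prodMk hs)).smul (by fun_prop)
    have ht : Measurable fun p : (Fin (n + 1) → F) × F => ⟪p.1 (Fin.last n) -
        ∑ i, projCoeffFin n (fun i => p.1 i.castSucc) (p.1 (Fin.last n)) i • p.1 i.castSucc, p.2⟫ /
        ‖p.1 (Fin.last n) - ∑ i, projCoeffFin n (fun i => p.1 i.castSucc) (p.1 (Fin.last n)) i •
          p.1 i.castSucc‖ ^ 2 :=
      (ha.inner measurable_snd).div (ha.norm.pow_const 2)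
    refine Fin.lastCases ?_ (fun i => ?_) i
    · simpa only [projCoeffFin, Fin.snoc_last] using ht
    · simp only [projCoeffFin, Fin.snoc_castSucc]
      exact (ih i).comp (hx.prodMk (measurable_snd.sub (ht.smul hs)))

theorem measurable_projCoeff (i : ι) :
    Measurable fun p : (ι → F) × F => projCoeff p.1 p.2 i := by
  refine (measurable_projCoeffFin _ (Fintype.equivFin ι i)).comp
    (Measurable.prodMk ?_ measurable_snd)
  fun_prop

theorem measurable_proj : Measurable fun p : (ι → F) × F => proj p.1 p.2 :=
  Finset.measurable_fun_sum _ fun i _ => (measurable_projCoeff i).smul (by fun_prop)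

theorem measurable_perp : Measurable fun p : (ι → F) × F => perp p.1 p.2 :=
  measurable_snd.sub measurable_proj

end ProjectionCoefficients

/-! ### Action of orthogonal matrices on Euclidean space. -/

section Matrices

variable {d : ℕ}

instance : SecondCountableTopology (Matrix (Fin d) (Fin d) ℝ) :=
  inferInstanceAs (SecondCountableTopology (Fin d → Fin d → ℝ))

instance : TopologicalSpace.MetrizableSpace (Matrix (Fin d) (Fin d) ℝ) :=
  inferInstanceAs (TopologicalSpace.MetrizableSpace (Fin d → Fin d → ℝ))

instance : SecondCountableTopology (Matrix.orthogonalGroup (Fin d) ℝ) :=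
  TopologicalSpace.Subtype.secondCountableTopology _

@[simp] theorem mulv_one (x : E d) : mulv 1 x = x := by simp [mulv]

theorem mulv_mul (A B : Matrix (Fin d) (Fin d) ℝ) (x : E d) :
    mulv (A * B) x = mulv A (mulv B x) := by
  simp [mulv, Matrix.toLpLin_apply]

theorem mulv_apply (A : Matrix (Fin d) (Fin d) ℝ) (x : E d) (i : Fin d) :
    mulv A x i = ∑ j, A i j * x j := by
  simp [mulv, Matrix.toLpLin_apply, Matrix.mulVec, dotProduct]

theorem smul_eq_mulv (g : Matrix.orthogonalGroup (Fin d) ℝ) (x : E d) :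
    g • x = mulv (g : Matrix (Fin d) (Fin d) ℝ) x := rfl

theorem inner_mulv (A : Matrix (Fin d) (Fin d) ℝ) (x y : E d) :
    ⟪mulv A x, y⟫ = ⟪x, mulv A.transpose y⟫ := by
  simp only [PiLp.inner_apply, mulv_apply, Matrix.transpose_apply, RCLike.inner_apply, conj_trivial,
    Finset.mul_sum, Finset.sum_mul]
  rw [Finset.sum_comm]
  refine Finset.sum_congr rfl fun _ _ => Finset.sum_congr rfl fun _ _ => by ring

theorem continuous_mulv : Continuous fun p : Matrix (Fin d) (Fin d) ℝ × E d => mulv p.1 p.2 := by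
  simp only [mulv, Matrix.toLpLin_apply]
  fun_prop

theorem mulv_add (A : Matrix (Fin d) (Fin d) ℝ) (x y : E d) :
    mulv A (x + y) = mulv A x + mulv A y := map_add _ _ _

theorem mulv_neg (A : Matrix (Fin d) (Fin d) ℝ) (x : E d) : mulv A (-x) = -mulv A x := map_neg _ _

theorem mulv_smul (A : Matrix (Fin d) (Fin d) ℝ) (c : ℝ) (x : E d) :
    mulv A (c • x) = c • mulv A x := map_smul _ _ _

theorem mulv_sum {ι : Type*} (A : Matrix (Fin d) (Fin d) ℝ) (s : Finset ι) (x : ι → E d) :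
    mulv A (∑ i ∈ s, x i) = ∑ i ∈ s, mulv A (x i) := map_sum _ _ _

theorem ext_mulv {A B : Matrix (Fin d) (Fin d) ℝ} (h : ∀ x : E d, mulv A x = mulv B x) : A = B :=
  Matrix.toEuclideanLin.injective (LinearMap.ext h)

theorem orthogonal_transpose_mul (g : Matrix.orthogonalGroup (Fin d) ℝ) :
    (g : Matrix (Fin d) (Fin d) ℝ).transpose * (g : Matrix (Fin d) (Fin d) ℝ) = 1 :=
  (Matrix.mem_orthogonalGroup_iff' _ _).1 g.2

theorem orthogonal_mul_transpose (g : Matrix.orthogonalGroup (Fin d) ℝ) :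
    (g : Matrix (Fin d) (Fin d) ℝ) * (g : Matrix (Fin d) (Fin d) ℝ).transpose = 1 :=
  (Matrix.mem_orthogonalGroup_iff _ _).1 g.2

theorem orthogonal_inv_val (g : Matrix.orthogonalGroup (Fin d) ℝ) :
    ((g⁻¹ : Matrix.orthogonalGroup (Fin d) ℝ) : Matrix (Fin d) (Fin d) ℝ) =
      (g : Matrix (Fin d) (Fin d) ℝ).transpose := rfl

theorem norm_mulv_orthogonal (g : Matrix.orthogonalGroup (Fin d) ℝ) (x : E d) :
    ‖mulv (g : Matrix (Fin d) (Fin d) ℝ) x‖ = ‖x‖ := by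
  rw [← sq_eq_sq₀ (norm_nonneg _) (norm_nonneg _), ← real_inner_self_eq_norm_sq,
    ← real_inner_self_eq_norm_sq, inner_mulv, ← mulv_mul, orthogonal_transpose_mul, mulv_one]

instance : CompactSpace (Matrix.orthogonalGroup (Fin d) ℝ) := by
  suffices h : IsCompact (Matrix.orthogonalGroup (Fin d) ℝ : Set (Matrix (Fin d) (Fin d) ℝ)) from
    isCompact_iff_compactSpace.1 h
  have hcl : IsClosed (Matrix.orthogonalGroup (Fin d) ℝ : Set (Matrix (Fin d) (Fin d) ℝ)) := by
    have : (Matrix.orthogonalGroup (Fin d) ℝ : Set (Matrix (Fin d) (Fin d) ℝ)) =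
        {A | A.transpose * A = 1} := by
      ext A
      exact Matrix.mem_orthogonalGroup_iff' _ _
    rw [this]
    exact isClosed_eq (by fun_prop) continuous_const
  have hK : IsCompact (Set.univ.pi fun _ => Set.univ.pi fun _ => Set.Icc (-1) 1 :
      Set (Fin d → Fin d → ℝ)) :=
    isCompact_univ_pi fun _ => isCompact_univ_pi fun _ => isCompact_Icc
  refine IsCompact.of_isClosed_subset hK hcl fun A hA i _ j _ => ?_
  have h := norm_mulv_orthogonal ⟨A, hA⟩ (EuclideanSpace.single j 1)
  have h2 := PiLp.norm_apply_le (mulv A (EuclideanSpace.single j (1 : ℝ))) i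
  rw [h] at h2
  rw [Set.mem_Icc, ← abs_le]
  simpa [mulv_apply] using h2

instance : ContinuousSMul (Matrix.orthogonalGroup (Fin d) ℝ) (E d) :=
  ⟨continuous_mulv.comp ((continuous_subtype_val.comp continuous_fst).prodMk continuous_snd)⟩

instance : IsIsometricSMul (Matrix.orthogonalGroup (Fin d) ℝ) (E d) := by
  refine ⟨fun g => Isometry.of_dist_eq fun x y => ?_⟩
  have : mulv (g : Matrix (Fin d) (Fin d) ℝ) x - mulv (g : Matrix (Fin d) (Fin d) ℝ) y =
      mulv (g : Matrix (Fin d) (Fin d) ℝ) (x - y) := (map_sub _ _ _).symm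
  rw [dist_eq_norm, dist_eq_norm, smul_eq_mulv, smul_eq_mulv, this, norm_mulv_orthogonal]

/-- A rotation as an orthogonal matrix. -/
def toOrthogonal (R : Matrix.specialOrthogonalGroup (Fin d) ℝ) : Matrix.orthogonalGroup (Fin d) ℝ :=
  ⟨R.1, Matrix.specialUnitaryGroup_le_unitaryGroup R.2⟩

theorem measurable_toOrthogonal : Measurable (toOrthogonal (d := d)) :=
  measurable_subtype_coe.subtype_mk

end Matrices

/-! ### Plane rotations as products of two reflections. -/

section Reflections

variable {d : ℕ}

/-- The matrix of the reflection in the hyperplane orthogonal to `r` (the identity if `r = 0`). -/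
noncomputable def reflMat (r : E d) : Matrix (Fin d) (Fin d) ℝ :=
  1 + Matrix.vecMulVec (fun i => -(2 / ‖r‖ ^ 2) * r i) (fun i => r i)

theorem mulv_reflMat (r x : E d) : mulv (reflMat r) x = x - (2 * ⟪r, x⟫ / ‖r‖ ^ 2) • r := by
  ext i
  simp only [mulv_apply, reflMat, Matrix.add_apply, Matrix.one_apply, Matrix.vecMulVec_apply,
    add_mul, Finset.sum_add_distrib, PiLp.sub_apply, PiLp.smul_apply, PiLp.inner_apply,
    RCLike.inner_apply, conj_trivial, smul_eq_mul, ite_mul, one_mul, zero_mul,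
    Finset.sum_ite_eq, Finset.mem_univ, if_true]
  rw [sub_eq_add_neg, Finset.mul_sum, Finset.sum_div, Finset.sum_mul, ← Finset.sum_neg_distrib]
  congr 1
  exact Finset.sum_congr rfl fun j _ => by ring

theorem reflMat_transpose (r : E d) : (reflMat r).transpose = reflMat r := by
  ext i j
  simp only [reflMat, Matrix.transpose_apply, Matrix.add_apply, Matrix.one_apply,
    Matrix.vecMulVec_apply, eq_comm (a := i) (b := j)]
  ring

theorem reflMat_mem_orthogonalGroup (r : E d) : reflMat r ∈ Matrix.orthogonalGroup (Fin d) ℝ := by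
  rw [Matrix.mem_orthogonalGroup_iff']
  change (reflMat r).transpose * reflMat r = 1
  rw [reflMat_transpose]
  refine ext_mulv fun x => ?_
  rw [mulv_mul, mulv_one, mulv_reflMat, mulv_reflMat, inner_sub_right, real_inner_smul_right,
    real_inner_self_eq_norm_sq]
  by_cases h : r = 0
  · simp [h]
  · have h' := norm_ne_zero_iff.2 h
    rw [sub_sub, ← add_smul]
    have : 2 * ⟪r, x⟫ / ‖r‖ ^ 2 +
        2 * (⟪r, x⟫ - 2 * ⟪r, x⟫ / ‖r‖ ^ 2 * ‖r‖ ^ 2) / ‖r‖ ^ 2 = 0 := by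
      field_simp
      ring
    rw [this, zero_smul, sub_zero]

theorem det_reflMat {r : E d} (hr : r ≠ 0) : (reflMat r).det = -1 := by
  have h := Matrix.det_one_add_replicateCol_mul_replicateRow (ι := Unit)
    (fun i => -(2 / ‖r‖ ^ 2) * r i) (fun i => r i)
  have h2 : (fun i => r i) ⬝ᵥ (fun i => -(2 / ‖r‖ ^ 2) * r i) = -2 := by
    have h3 : ∑ i, r i * r i = ‖r‖ ^ 2 := by
      rw [EuclideanSpace.real_norm_sq_eq]
      exact Finset.sum_congr rfl fun i _ => by ring
    have h' := norm_ne_zero_iff.2 hr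
    calc _ = -(2 / ‖r‖ ^ 2) * ∑ i, r i * r i := by
          rw [dotProduct, Finset.mul_sum]
          exact Finset.sum_congr rfl fun i _ => by ring
      _ = -2 := by rw [h3]; field_simp
  rw [h2] at h
  rw [reflMat, Matrix.vecMulVec_eq Unit, h]
  norm_num

theorem measurable_reflMat : Measurable (reflMat (d := d)) := by
  refine measurable_pi_lambda _ fun i => measurable_pi_lambda _ fun j => ?_
  simp only [reflMat, Matrix.add_apply, Matrix.vecMulVec_apply]
  have : ∀ i, Measurable fun r : E d => r i := fun i => by fun_prop
  fun_prop

/-- The bisector of the directions of `a` and `u`. -/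
noncomputable def bisector (a u : E d) : E d := ‖a‖⁻¹ • a + ‖u‖⁻¹ • u

open Classical in
/-- The rotation in the plane of `a` and `u` that takes the direction of `a` to that of `u` (the
identity in the degenerate cases). -/
noncomputable def planeRot (a u : E d) : Matrix.specialOrthogonalGroup (Fin d) ℝ :=
  ⟨if a ≠ 0 ∧ bisector a u ≠ 0 then reflMat (bisector a u) * reflMat a else 1, by
    split_ifs with h
    · refine Matrix.mem_specialOrthogonalGroup_iff.2
        ⟨mul_mem (reflMat_mem_orthogonalGroup _) (reflMat_mem_orthogonalGroup _), ?_⟩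
      rw [Matrix.det_mul, det_reflMat h.1, det_reflMat h.2]
      norm_num
    · exact one_mem _⟩

theorem mulv_planeRot_of_inner_eq_zero {a u x : E d} (ha : ⟪a, x⟫ = 0) (hu : ⟪u, x⟫ = 0) :
    mulv (planeRot a u : Matrix (Fin d) (Fin d) ℝ) x = x := by
  have hb : ⟪bisector a u, x⟫ = 0 := by
    simp [bisector, inner_add_left, real_inner_smul_left, ha, hu]
  simp only [planeRot]
  split_ifs
  · rw [mulv_mul, mulv_reflMat, mulv_reflMat, ha]
    simp [hb]
  · simp

/-- The first reflection sends `a` to `-a`, and the one along the bisector sends `-a` to a positive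
multiple of `u`. The hypothesis excludes opposite directions, for which the bisector vanishes. -/
theorem mulv_planeRot {a u : E d} (hu : u ∉ Submodule.span ℝ {a}) :
    mulv (planeRot a u : Matrix (Fin d) (Fin d) ℝ) a = (‖a‖ / ‖u‖) • u := by
  by_cases ha : a = 0
  · simp [planeRot, ha]
  have hu0 : u ≠ 0 := fun h => hu (h ▸ Submodule.zero_mem _)
  have hna := norm_ne_zero_iff.2 ha
  have hnu := norm_ne_zero_iff.2 hu0
  have hb : bisector a u ≠ 0 := by
    intro h
    refine hu (Submodule.mem_span_singleton.2 ⟨-(‖u‖ * ‖a‖⁻¹), ?_⟩)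
    have h2 : ‖u‖⁻¹ • u = -(‖a‖⁻¹ • a) := by
      rw [eq_neg_iff_add_eq_zero, add_comm]; exact h
    have h3 : u = ‖u‖ • (‖u‖⁻¹ • u) := by rw [smul_smul, mul_inv_cancel₀ hnu, one_smul]
    calc -(‖u‖ * ‖a‖⁻¹) • a = ‖u‖ • -(‖a‖⁻¹ • a) := by rw [smul_neg, smul_smul, neg_smul]
      _ = u := by rw [← h2, ← h3]
  simp only [planeRot]
  rw [if_pos ⟨ha, hb⟩, mulv_mul, mulv_reflMat a a, real_inner_self_eq_norm_sq]
  have h1 : a - (2 * ‖a‖ ^ 2 / ‖a‖ ^ 2) • a = -a := by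
    rw [mul_div_cancel_right₀ _ (by positivity), two_smul]; abel
  rw [h1, mulv_neg, mulv_reflMat]
  have hin : ⟪bisector a u, a⟫ = ‖a‖ + ‖u‖⁻¹ * ⟪u, a⟫ := by
    rw [bisector, inner_add_left, real_inner_smul_left, real_inner_smul_left,
      real_inner_self_eq_norm_sq]
    field_simp
  have hns : ‖bisector a u‖ ^ 2 = 2 + 2 * (‖a‖⁻¹ * (‖u‖⁻¹ * ⟪u, a⟫)) := by
    rw [bisector, norm_add_sq_real, real_inner_smul_left, real_inner_smul_right, norm_smul,
      norm_smul, norm_inv, norm_inv, norm_norm, norm_norm, inv_mul_cancel₀ hna, inv_mul_cancel₀ hnu,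
      real_inner_comm]
    ring
  -- With this coefficient the reflection of `-a` is `-a + ‖a‖ • bisector a u`, in which `a`
  -- cancels.
  have hk : 2 * ⟪bisector a u, a⟫ / ‖bisector a u‖ ^ 2 = ‖a‖ := by
    rw [div_eq_iff (pow_ne_zero 2 (norm_ne_zero_iff.2 hb)), hin, hns]
    field_simp
  rw [hk, bisector, smul_add, smul_smul, smul_smul, mul_inv_cancel₀ hna, one_smul, div_eq_mul_inv]
  abel

theorem measurable_planeRot : Measurable fun p : E d × E d => planeRot p.1 p.2 := by
  refine Measurable.subtype_mk ?_
  have hb : Measurable fun p : E d × E d => bisector p.1 p.2 := by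
    unfold bisector
    fun_prop
  refine Measurable.ite ?_ ?_ measurable_const
  · exact ((measurableSet_singleton (0 : E d)).compl.preimage measurable_fst).inter
      ((measurableSet_singleton (0 : E d)).compl.preimage hb)
  · exact (measurable_reflMat.comp hb).mul (measurable_reflMat.comp measurable_fst)

end Reflections

/-! ### Queries, their information, and conjugation invariance given the information. -/

section Info

variable {d : ℕ}

theorem oracleIdx_subset_product (k : ℕ) :
    oracleIdx k ⊆ (Finset.range (k + 1) ×ˢ Finset.range k : Finset (ℕ × ℕ)) := by
  rintro ⟨i, j⟩ ⟨h1, h2⟩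
  simp only [Finset.coe_product, Set.mem_prod, Finset.coe_range, Set.mem_Iio] at *
  omega

theorem krylovIdx_finite (k : ℕ) : (krylovIdx k).Finite := by
  refine (Finset.finite_toSet (Finset.range (k + 1) ×ˢ Finset.range (k + 1))).subset ?_
  rintro ⟨i, j⟩ h
  have h : i + j ≤ k := h
  simp only [Finset.coe_product, Set.mem_prod, Finset.coe_range, Set.mem_Iio]
  omega

noncomputable instance (k : ℕ) : Fintype (oracleIdx k) :=
  ((Finset.finite_toSet _).subset (oracleIdx_subset_product k)).fintype

noncomputable instance (k : ℕ) : Fintype (krylovIdx k) := (krylovIdx_finite k).fintype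

theorem card_oracleIdx_le (k : ℕ) : Fintype.card (oracleIdx k) ≤ (k + 1) * k := by
  rw [← Nat.card_eq_fintype_card, Nat.card_coe_set_eq]
  refine (Set.ncard_le_ncard (oracleIdx_subset_product k) (Finset.finite_toSet _)).trans ?_
  rw [Set.ncard_coe_finset]
  simp

/-- A sequence of queries of an adaptive deterministic algorithm. -/
abbrev Queries (d : ℕ) : Type := (k : ℕ) → (oracleIdx k → E d) → E d

/-- The queries that are made on input `A`. -/
noncomputable def queryVec (q : Queries d) (A : Matrix (Fin d) (Fin d) ℝ) (k : ℕ) : E d :=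
  q k fun p => mulv (A ^ p.1.1) (queryVec q A p.1.2)
termination_by k
decreasing_by exact p.2.2

/-- The information that is available after `k` queries on input `A`. -/
noncomputable def info (q : Queries d) (A : Matrix (Fin d) (Fin d) ℝ) (k : ℕ) :
    oracleIdx k → E d :=
  fun p => mulv (A ^ p.1.1) (queryVec q A p.1.2)

theorem queryVec_eq (q : Queries d) (A : Matrix (Fin d) (Fin d) ℝ) (k : ℕ) :
    queryVec q A k = q k (info q A k) := by
  rw [queryVec]
  rfl

theorem measurable_mulv {X : Type*} [MeasurableSpace X]
    {A : X → Matrix (Fin d) (Fin d) ℝ} (hA : Measurable A) {v : X → E d} (hv : Measurable v) :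
    Measurable fun x => mulv (A x) (v x) := by
  have := continuous_mulv.measurable.comp (hA.prodMk hv)
  exact this

theorem measurable_mulv_pow (i : ℕ) {X : Type*} [MeasurableSpace X]
    {A : X → Matrix (Fin d) (Fin d) ℝ} (hA : Measurable A) {v : X → E d} (hv : Measurable v) :
    Measurable fun x => mulv (A x ^ i) (v x) := by
  have hp : Continuous fun B : Matrix (Fin d) (Fin d) ℝ => B ^ i := continuous_pow i
  have := hp.measurable.comp hA
  exact measurable_mulv this hv

theorem measurable_queryVec {q : Queries d} (hq : ∀ k, Measurable (q k)) (k : ℕ) :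
    Measurable fun A => queryVec q A k := by
  induction k using Nat.strong_induction_on with
  | _ k ih =>
    simp only [queryVec_eq]
    exact (hq k).comp (measurable_pi_lambda _ fun p =>
      measurable_mulv_pow _ measurable_id (ih _ p.2.2))

theorem measurable_info {q : Queries d} (hq : ∀ k, Measurable (q k)) (k : ℕ) :
    Measurable fun A => info q A k :=
  measurable_pi_lambda _ fun _ => measurable_mulv_pow _ measurable_id (measurable_queryVec hq _)

/-- Conjugation of a matrix by an orthogonal matrix. -/
def orthConj (g : Matrix.orthogonalGroup (Fin d) ℝ) (A : Matrix (Fin d) (Fin d) ℝ) :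
    Matrix (Fin d) (Fin d) ℝ :=
  (g : Matrix (Fin d) (Fin d) ℝ) * A * (g : Matrix (Fin d) (Fin d) ℝ).transpose

theorem orthConj_mul (g h : Matrix.orthogonalGroup (Fin d) ℝ) (A : Matrix (Fin d) (Fin d) ℝ) :
    orthConj (g * h) A = orthConj g (orthConj h A) := by
  simp only [orthConj, Matrix.UnitaryGroup.mul_val, Matrix.transpose_mul, Matrix.mul_assoc]

theorem measurable_orthConj : Measurable fun p : Matrix (Fin d) (Fin d) ℝ ×
    Matrix.orthogonalGroup (Fin d) ℝ => orthConj p.2 p.1 := by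
  refine Continuous.measurable ?_
  unfold orthConj
  fun_prop

theorem orthConj_pow (g : Matrix.orthogonalGroup (Fin d) ℝ) (A : Matrix (Fin d) (Fin d) ℝ)
    (i : ℕ) : orthConj g A ^ i = orthConj g (A ^ i) := by
  induction i with
  | zero => simp [orthConj, orthogonal_mul_transpose]
  | succ i ih =>
    rw [pow_succ, ih, pow_succ]
    simp only [orthConj, Matrix.mul_assoc]
    rw [← Matrix.mul_assoc (g : Matrix (Fin d) (Fin d) ℝ).transpose (g : Matrix (Fin d) (Fin d) ℝ),
      orthogonal_transpose_mul, Matrix.one_mul]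

theorem mulv_orthConj_smul (g : Matrix.orthogonalGroup (Fin d) ℝ)
    (A : Matrix (Fin d) (Fin d) ℝ) (x : E d) : mulv (orthConj g A) (g • x) = g • mulv A x := by
  simp only [orthConj, smul_eq_mulv, mulv_mul]
  rw [← mulv_mul _ _ x, orthogonal_transpose_mul, mulv_one]

variable {q : Queries d}

theorem smul_queryVec_of_smul_info {g : Matrix.orthogonalGroup (Fin d) ℝ}
    {A : Matrix (Fin d) (Fin d) ℝ} {k : ℕ} (h : g • info q A k = info q A k) {j : ℕ} (hj : j < k) :
    g • queryVec q A j = queryVec q A j := by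
  have := congrFun h ⟨(0, j), by constructor <;> simp [hj, hj.le]⟩
  simpa [info] using this

/-- If `g` fixes `v_j` and `A^i v_j`, then `(g A gᵀ)^i v_j = g A^i v_j = A^i v_j`. The case `j = k`
is included, because query `k` uses only the information that `g` fixes. -/
theorem queryVec_orthConj {g : Matrix.orthogonalGroup (Fin d) ℝ}
    {A : Matrix (Fin d) (Fin d) ℝ} {k : ℕ} (h : g • info q A k = info q A k) {j : ℕ} (hj : j ≤ k) :
    queryVec q (orthConj g A) j = queryVec q A j := by
  induction j using Nat.strong_induction_on with
  | _ j ih =>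
    rw [queryVec_eq, queryVec_eq]
    congr 1
    ext1 p
    have hp := p.2.2
    have hp1 := p.2.1
    have h1 := congrFun h ⟨p.1, hp1.trans hj, hp.trans_le hj⟩
    simp only [info, Pi.smul_apply] at h1 ⊢
    rw [ih _ hp (hp.le.trans hj), orthConj_pow]
    conv_lhs => rw [← smul_queryVec_of_smul_info h (hp.trans_le hj)]
    rw [mulv_orthConj_smul, h1]

theorem info_orthConj {g : Matrix.orthogonalGroup (Fin d) ℝ}
    {A : Matrix (Fin d) (Fin d) ℝ} {k : ℕ} (h : g • info q A k = info q A k) :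
    info q (orthConj g A) k = info q A k := by
  ext1 p
  have h1 := congrFun h p
  simp only [info, Pi.smul_apply] at h1 ⊢
  rw [queryVec_orthConj h p.2.2.le, orthConj_pow]
  conv_lhs => rw [← smul_queryVec_of_smul_info h p.2.2]
  rw [mulv_orthConj_smul, h1]

/-- The conditional law of a conjugation-invariant random matrix given the information after `k`
queries is invariant under conjugation by the stabilizer of this information. -/
theorem isStabilizerAveraged_info (hq : ∀ k, Measurable (q k))
    {ν : Measure (Matrix (Fin d) (Fin d) ℝ)} [SFinite ν] (hν : ∀ g, ν.map (orthConj g) = ν)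
    (k : ℕ) : IsStabilizerAveraged orthConj ν fun A => info q A k := by
  induction k with
  | zero =>
    have : IsEmpty (oracleIdx 0) := ⟨fun p => absurd p.2.2 (Nat.not_lt_zero _)⟩
    exact isStabilizerAveraged_of_subsingleton measurable_orthConj hν
  | succ k ih =>
    -- The query is adjoined first, as a function of the information. Once `g` fixes it too, the new
    -- products `A^i v_j` transform equivariantly, which is the second enlargement.
    have h1 := ih.comp (φ := fun I => (I, q k I)) measurable_orthConj orthConj_mul
      (measurable_info hq k) (fun A g h => info_orthConj h) (measurable_id.prodMk (hq k))
      (fun A g h => (Prod.ext_iff.1 h).1)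
    refine h1.of_equivariant measurable_orthConj orthConj_mul (measurable_info hq (k + 1)) ?_ ?_
    · intro A g h
      obtain ⟨hI, hw⟩ := Prod.ext_iff.1 h
      have hI : g • info q A k = info q A k := hI
      have hw : g • q k (info q A k) = q k (info q A k) := hw
      rw [← queryVec_eq q A k] at hw
      ext1 p
      have hfix : g • queryVec q A p.1.2 = queryVec q A p.1.2 := by
        rcases Nat.lt_succ_iff_lt_or_eq.1 p.2.2 with h | h
        · exact smul_queryVec_of_smul_info hI h
        · rw [h, hw]
      simp only [info, Pi.smul_apply]
      rw [queryVec_orthConj hI (Nat.lt_succ_iff.1 p.2.2), orthConj_pow]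
      conv_lhs => rw [← hfix]
      rw [mulv_orthConj_smul]
    · intro A g h
      have hI : g • info q A k = info q A k := by
        ext1 p
        exact congrFun h ⟨p.1, p.2.1.trans (Nat.le_succ k), p.2.2.trans (Nat.lt_succ_self k)⟩
      refine Prod.ext hI ?_
      change g • q k (info q A k) = q k (info q A k)
      rw [← queryVec_eq q A k]
      exact smul_queryVec_of_smul_info h (Nat.lt_succ_self k)

theorem map_orthConj_info (hq : ∀ k, Measurable (q k))
    {ν : Measure (Matrix (Fin d) (Fin d) ℝ)} [SFinite ν] (hν : ∀ g, ν.map (orthConj g) = ν)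
    (k : ℕ) {Ψ : (oracleIdx k → E d) → Matrix.orthogonalGroup (Fin d) ℝ} (hΨ : Measurable Ψ)
    (hfix : ∀ I, Ψ I • I = I) :
    ν.map (fun A => orthConj (Ψ (info q A k)) A) = ν :=
  (isStabilizerAveraged_info hq hν k).map_eq measurable_orthConj orthConj_mul
    (measurable_info hq k) (fun _ _ h => info_orthConj h) hΨ fun _ => hfix _

/-! ### One step of the simulation and its genericity. -/

/-- The rotation that replaces the new direction of the next query by the direction of `ζ`. -/
noncomputable def stepRot (q : Queries d) (k : ℕ) (I : oracleIdx k → E d) (ζ : E d) :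
    Matrix.specialOrthogonalGroup (Fin d) ℝ :=
  planeRot (perp I (q k I)) (perp I ζ)

/-- The next query with its new direction replaced by the direction of `ζ`. -/
noncomputable def stepVec (q : Queries d) (k : ℕ) (I : oracleIdx k → E d) (ζ : E d) : E d :=
  proj I (q k I) + (‖perp I (q k I)‖ / ‖perp I ζ‖) • perp I ζ

/-- The direction of `ζ` is in general position with respect to the information and the next
query. -/
def IsGeneric (q : Queries d) (k : ℕ) (I : oracleIdx k → E d) (ζ : E d) : Prop :=
  perp I ζ ∉ Submodule.span ℝ {perp I (q k I)}

theorem stepRot_smul (k : ℕ) (I : oracleIdx k → E d) (ζ : E d) :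
    toOrthogonal (stepRot q k I ζ) • I = I := by
  ext1 p
  refine mulv_planeRot_of_inner_eq_zero ?_ ?_ <;>
  · rw [real_inner_comm]
    exact inner_perp _ _ _

theorem mulv_stepRot {k : ℕ} {I : oracleIdx k → E d} {ζ : E d} (h : IsGeneric q k I ζ) :
    mulv (stepRot q k I ζ : Matrix (Fin d) (Fin d) ℝ) (q k I) = stepVec q k I ζ := by
  conv_lhs => rw [← proj_add_perp I (q k I)]
  rw [mulv_add, stepRot, mulv_planeRot h, mulv_planeRot_of_inner_eq_zero]
  · rfl
  all_goals
    rw [real_inner_comm]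
    exact inner_perp_of_mem_span (proj_mem_span _ _) _

theorem stepVec_mem_span (k : ℕ) (I : oracleIdx k → E d) (ζ : E d) :
    stepVec q k I ζ ∈ Submodule.span ℝ (Set.range I) ⊔ Submodule.span ℝ {ζ} := by
  have hle : Submodule.span ℝ (Set.range I) ≤
    Submodule.span ℝ (Set.range I) ⊔ Submodule.span ℝ {ζ} := le_sup_left
  refine Submodule.add_mem _ (hle (proj_mem_span _ _)) (Submodule.smul_mem _ _ ?_)
  exact Submodule.sub_mem _
    (Submodule.mem_sup_right (Submodule.mem_span_singleton_self ζ)) (hle (proj_mem_span _ _))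

theorem measurable_stepRot (hq : ∀ k, Measurable (q k)) (k : ℕ) :
    Measurable fun p : (oracleIdx k → E d) × E d => stepRot q k p.1 p.2 :=
  measurable_planeRot.comp ((measurable_perp.comp (measurable_fst.prodMk
    ((hq k).comp measurable_fst))).prodMk measurable_perp)

theorem measurable_stepVec (hq : ∀ k, Measurable (q k)) (k : ℕ) :
    Measurable fun p : (oracleIdx k → E d) × E d => stepVec q k p.1 p.2 := by
  have h1 : Measurable fun p : (oracleIdx k → E d) × E d => (p.1, q k p.1) :=
    measurable_fst.prodMk ((hq k).comp measurable_fst)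
  exact (measurable_proj.comp h1).add
    (((measurable_perp.comp h1).norm.div measurable_perp.norm).smul measurable_perp)

/-- A nonzero vector orthogonal to `W` gives a functional that vanishes on `W` and has a
nondegenerate Gaussian law. -/
theorem stdGaussian_submodule_eq_zero {W : Submodule ℝ (E d)} (hW : W ≠ ⊤) :
    stdGaussian (E d) W = 0 := by
  have h : Wᗮ ≠ ⊥ := fun h => hW (Submodule.orthogonal_eq_bot_iff.1 h)
  obtain ⟨e, he, he0⟩ := Submodule.exists_mem_ne_zero_of_ne_bot h
  set L : StrongDual ℝ (E d) := innerSL ℝ e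
  have hmap := IsGaussian.map_eq_gaussianReal (μ := stdGaussian (E d)) L
  rw [variance_dual_stdGaussian] at hmap
  have hsub : (W : Set (E d)) ⊆ L ⁻¹' {0} := by
    intro v hv
    have := (Submodule.mem_orthogonal W e).1 he v hv
    rw [real_inner_comm] at this
    simpa [L] using this
  refine measure_mono_null hsub ?_
  rw [← Measure.map_apply (by fun_prop) (measurableSet_singleton 0), hmap]
  have : NullSingletonClass (gaussianReal (∫ x, L x ∂stdGaussian (E d)) (‖L‖ ^ 2).toNNReal) := by
    refine nullSingletonClass_gaussianReal ?_
    have : 0 < ‖L‖ := by simpa [L] using he0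
    simpa using this.ne'
  exact measure_singleton _

theorem ae_isGeneric {k : ℕ} (hk : (k + 1) ^ 2 < d) (I : oracleIdx k → E d) :
    ∀ᵐ ζ ∂stdGaussian (E d), IsGeneric q k I ζ := by
  set W := Submodule.span ℝ (Set.range I) ⊔ Submodule.span ℝ {perp I (q k I)}
  have hW : W ≠ ⊤ := by
    intro h
    -- At most `(k + 1) * k` information vectors, plus one for the new direction of the query; this
    -- is at most `(k + 1) ^ 2`.
    have h1 : Module.finrank ℝ W ≤ (k + 1) * k + 1 := by
      refine (Submodule.finrank_add_le_finrank_add_finrank _ _).trans (Nat.add_le_add ?_ ?_)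
      · exact (finrank_range_le_card I).trans (card_oracleIdx_le k)
      · exact (finrank_span_le_card _).trans (by simp)
    rw [h, finrank_top, finrank_euclideanSpace_fin] at h1
    nlinarith
  refine measure_mono_null ?_ (stdGaussian_submodule_eq_zero hW)
  intro ζ hζ
  have hζ : perp I ζ ∈ Submodule.span ℝ {perp I (q k I)} := not_not.1 hζ
  have := Submodule.add_mem_sup (proj_mem_span I ζ) hζ
  rwa [proj_add_perp] at this

end Info

/-! ### The simulator computed from block Krylov data. -/

section Simulator

variable {d : ℕ} {q : Queries d}

/-- The vector `A ^ i * v` computed from the block Krylov data `x`, for `v` in the span of the data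
with indices in `krylovIdx j`. -/
noncomputable def krylovApply (x : ℕ × ℕ → E d) (j : ℕ) (v : E d) (i : ℕ) : E d :=
  ∑ c : krylovIdx j, projCoeff (fun c : krylovIdx j => x c.1) v c • x (c.1.1 + i, c.1.2)

/-- The information `A ^ i * v j` computed from the block Krylov data `x` and rotated back. -/
noncomputable def simInfo (x : ℕ × ℕ → E d)
    (s : (ℕ → E d) × Matrix.specialOrthogonalGroup (Fin d) ℝ)
    (k : ℕ) : oracleIdx k → E d :=
  fun p => mulv (s.2 : Matrix (Fin d) (Fin d) ℝ).transpose (krylovApply x p.1.2 (s.1 p.1.2) p.1.1)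

/-- The vector `z k` rotated back. -/
noncomputable def simNoise (x : ℕ × ℕ → E d)
    (s : (ℕ → E d) × Matrix.specialOrthogonalGroup (Fin d) ℝ)
    (k : ℕ) : E d :=
  mulv (s.2 : Matrix (Fin d) (Fin d) ℝ).transpose (x (0, k))

/-- The simulated queries and the accumulated rotation after `k` steps. -/
noncomputable def simState (q : Queries d) (x : ℕ × ℕ → E d) :
    ℕ → (ℕ → E d) × Matrix.specialOrthogonalGroup (Fin d) ℝ
  | 0 => (0, 1)
  | k + 1 =>
    let s := simState q x k
    (Function.update s.1 k (mulv (s.2 : Matrix (Fin d) (Fin d) ℝ)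
      (stepVec q k (simInfo x s k) (simNoise x s k))),
      s.2 * stepRot q k (simInfo x s k) (simNoise x s k))

/-- The simulated query number `k`. -/
noncomputable def simVec (q : Queries d) (x : ℕ × ℕ → E d) (k : ℕ) : E d :=
  mulv ((simState q x k).2 : Matrix (Fin d) (Fin d) ℝ)
    (stepVec q k (simInfo x (simState q x k) k) (simNoise x (simState q x k) k))

/-- The rotation of step `k`. -/
noncomputable def simRot (q : Queries d) (x : ℕ × ℕ → E d) (k : ℕ) :
    Matrix.specialOrthogonalGroup (Fin d) ℝ :=
  stepRot q k (simInfo x (simState q x k) k) (simNoise x (simState q x k) k)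

theorem simState_fst (x : ℕ × ℕ → E d) {j k : ℕ} (h : j < k) :
    (simState q x k).1 j = simVec q x j := by
  induction k with
  | zero => omega
  | succ k ih =>
    rcases Nat.lt_succ_iff_lt_or_eq.1 h with h | rfl
    · rw [← ih h]
      simp [simState, Function.update_of_ne h.ne]
    · simp [simState, simVec]

theorem simState_snd_succ (x : ℕ × ℕ → E d) (k : ℕ) :
    (simState q x (k + 1)).2 = (simState q x k).2 * simRot q x k := rfl

theorem simState_snd_eq_prod (x : ℕ × ℕ → E d) (k : ℕ) :
    (simState q x k).2 = (List.ofFn fun j : Fin k => simRot q x j).prod := by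
  induction k with
  | zero => rfl
  | succ k ih =>
    rw [List.ofFn_succ', List.concat_eq_append, List.prod_append, simState_snd_succ, ih]
    simp

/-- The simulator runs on a total family `x` to keep the recursion free of index bounds. This and
the following congruence lemmas recover which entries it really reads: shifting indices of total at
most `j` by `i` stays within `i + j`. -/
theorem krylovApply_congr {x y : ℕ × ℕ → E d} {j i k : ℕ} (h : ∀ p ∈ krylovIdx k, x p = y p)
    (hij : i + j ≤ k) (v : E d) : krylovApply x j v i = krylovApply y j v i := by
  have h1 : (fun c : krylovIdx j => x c.1) = fun c : krylovIdx j => y c.1 := by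
    funext c
    have hc : c.1.1 + c.1.2 ≤ j := c.2
    exact h _ (show _ ≤ k by omega)
  unfold krylovApply
  rw [h1]
  refine Finset.sum_congr rfl fun c _ => ?_
  have hc : c.1.1 + c.1.2 ≤ j := c.2
  rw [h _ (show c.1.1 + i + c.1.2 ≤ k by omega)]

theorem simInfo_congr {x y : ℕ × ℕ → E d} {k : ℕ} (h : ∀ p ∈ krylovIdx k, x p = y p)
    (s : (ℕ → E d) × Matrix.specialOrthogonalGroup (Fin d) ℝ) : simInfo x s k = simInfo y s k := by
  funext p
  unfold simInfo
  rw [krylovApply_congr h p.2.1]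

theorem simNoise_congr {x y : ℕ × ℕ → E d} {k : ℕ} (h : ∀ p ∈ krylovIdx k, x p = y p)
    (s : (ℕ → E d) × Matrix.specialOrthogonalGroup (Fin d) ℝ) : simNoise x s k = simNoise y s k := by
  unfold simNoise
  rw [h _ (show 0 + k ≤ k by omega)]

theorem simState_congr {x y : ℕ × ℕ → E d} {k : ℕ} (h : ∀ p : ℕ × ℕ, p.1 + p.2 < k → x p = y p) :
    simState q x k = simState q y k := by
  induction k with
  | zero => rfl
  | succ k ih =>
    have hk : ∀ p ∈ krylovIdx k, x p = y p := fun p hp => h p (Nat.lt_succ_of_le hp)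
    have hs := ih fun p hp => h p (hp.trans (Nat.lt_succ_self k))
    simp only [simState]
    rw [hs, simInfo_congr hk, simNoise_congr hk]

theorem simVec_congr {x y : ℕ × ℕ → E d} {k : ℕ} (h : ∀ p ∈ krylovIdx k, x p = y p) :
    simVec q x k = simVec q y k := by
  unfold simVec
  rw [simState_congr fun p hp => h p hp.le, simInfo_congr h, simNoise_congr h]

theorem simRot_congr {x y : ℕ × ℕ → E d} {k : ℕ} (h : ∀ p ∈ krylovIdx k, x p = y p) :
    simRot q x k = simRot q y k := by
  unfold simRot
  rw [simState_congr fun p hp => h p hp.le, simInfo_congr h, simNoise_congr h]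

theorem rot_mul_transpose (R : Matrix.specialOrthogonalGroup (Fin d) ℝ) :
    (R : Matrix (Fin d) (Fin d) ℝ) * (R : Matrix (Fin d) (Fin d) ℝ).transpose = 1 :=
  orthogonal_mul_transpose (toOrthogonal R)

theorem rot_transpose_mul (R : Matrix.specialOrthogonalGroup (Fin d) ℝ) :
    (R : Matrix (Fin d) (Fin d) ℝ).transpose * (R : Matrix (Fin d) (Fin d) ℝ) = 1 :=
  orthogonal_transpose_mul (toOrthogonal R)

theorem mulv_rot_mulv_transpose (R : Matrix.specialOrthogonalGroup (Fin d) ℝ) (v : E d) :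
    mulv (R : Matrix (Fin d) (Fin d) ℝ) (mulv (R : Matrix (Fin d) (Fin d) ℝ).transpose v) = v := by
  rw [← mulv_mul, rot_mul_transpose, mulv_one]

theorem mulv_transpose_mulv_rot (R : Matrix.specialOrthogonalGroup (Fin d) ℝ) (v : E d) :
    mulv (R : Matrix (Fin d) (Fin d) ℝ).transpose (mulv (R : Matrix (Fin d) (Fin d) ℝ) v) = v := by
  rw [← mulv_mul, rot_transpose_mul, mulv_one]

theorem simVec_mem_span (x : ℕ × ℕ → E d) (k : ℕ) :
    simVec q x k ∈ Submodule.span ℝ (Set.range fun p : krylovIdx k => x p.1) := by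
  set W := Submodule.span ℝ (Set.range fun p : krylovIdx k => x p.1)
  set s := simState q x k
  have hx : ∀ p ∈ krylovIdx k, x p ∈ W := fun p hp => Submodule.subset_span ⟨⟨p, hp⟩, rfl⟩
  have hle : Submodule.span ℝ (Set.range (simInfo x s k)) ⊔ Submodule.span ℝ {simNoise x s k} ≤
      W.comap (Matrix.toEuclideanLin (s.2 : Matrix (Fin d) (Fin d) ℝ)) := by
    refine sup_le (Submodule.span_le.2 ?_) (Submodule.span_le.2 ?_)
    · rintro _ ⟨p, rfl⟩
      change mulv _ (simInfo x s k p) ∈ W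
      rw [simInfo, mulv_rot_mulv_transpose]
      refine Submodule.sum_mem _ fun c _ => Submodule.smul_mem _ _ (hx _ ?_)
      have hc : c.1.1 + c.1.2 ≤ p.1.2 := c.2
      have hp : p.1.1 + p.1.2 ≤ k := p.2.1
      change _ + _ ≤ k
      dsimp only
      omega
    · rintro _ rfl
      change mulv _ (simNoise x s k) ∈ W
      rw [simNoise, mulv_rot_mulv_transpose]
      exact hx _ (show 0 + k ≤ k by omega)
  exact hle (stepVec_mem_span k _ _)

theorem measurable_krylovApply (j i : ℕ) :
    Measurable fun p : (ℕ × ℕ → E d) × E d => krylovApply p.1 j p.2 i := by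
  refine Finset.measurable_fun_sum _ fun c _ => ?_
  have h1 : Measurable fun p : (ℕ × ℕ → E d) × E d =>
      ((fun c : krylovIdx j => p.1 c.1), p.2) := by fun_prop
  have h2 : Measurable fun p : (ℕ × ℕ → E d) × E d => p.1 (c.1.1 + i, c.1.2) := by fun_prop
  exact ((measurable_projCoeff c).comp h1).smul h2

theorem measurable_transpose : Measurable fun A : Matrix (Fin d) (Fin d) ℝ => A.transpose :=
  Continuous.measurable (by fun_prop)

theorem measurable_simInfo (k : ℕ) : Measurable fun p : (ℕ × ℕ → E d) ×
    ((ℕ → E d) × Matrix.specialOrthogonalGroup (Fin d) ℝ) => simInfo p.1 p.2 k := by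
  refine measurable_pi_lambda _ fun p => measurable_mulv ?_ ?_
  · exact measurable_transpose.comp (measurable_subtype_coe.comp measurable_snd.snd)
  · have := (measurable_krylovApply (d := d) p.1.2 p.1.1).comp
      (measurable_fst.prodMk ((measurable_pi_apply p.1.2).comp measurable_snd.fst) :
        Measurable fun y : (ℕ × ℕ → E d) ×
          ((ℕ → E d) × Matrix.specialOrthogonalGroup (Fin d) ℝ) => (y.1, y.2.1 p.1.2))
    exact this

theorem measurable_simNoise (k : ℕ) : Measurable fun p : (ℕ × ℕ → E d) ×
    ((ℕ → E d) × Matrix.specialOrthogonalGroup (Fin d) ℝ) => simNoise p.1 p.2 k :=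
  measurable_mulv (measurable_transpose.comp (measurable_subtype_coe.comp measurable_snd.snd))
    ((measurable_pi_apply _).comp measurable_fst)

theorem measurable_simInfo_simNoise (k : ℕ) {s : (ℕ × ℕ → E d) →
    (ℕ → E d) × Matrix.specialOrthogonalGroup (Fin d) ℝ} (hs : Measurable s) :
    Measurable fun x => (simInfo x (s x) k, simNoise x (s x) k) := by
  have := ((measurable_simInfo k).comp (measurable_id.prodMk hs)).prodMk
    ((measurable_simNoise k).comp (measurable_id.prodMk hs))
  exact this

theorem measurable_rot_mul {X : Type*} [MeasurableSpace X]
    {R R' : X → Matrix.specialOrthogonalGroup (Fin d) ℝ} (hR : Measurable R) (hR' : Measurable R') :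
    Measurable fun x => R x * R' x := by
  refine Measurable.subtype_mk (f := fun x =>
    (R x : Matrix (Fin d) (Fin d) ℝ) * (R' x : Matrix (Fin d) (Fin d) ℝ)) ?_
  exact (measurable_subtype_coe.comp hR).mul (measurable_subtype_coe.comp hR')

theorem measurable_simState (hq : ∀ k, Measurable (q k)) (k : ℕ) :
    Measurable fun x : ℕ × ℕ → E d => simState q x k := by
  induction k with
  | zero => exact measurable_const
  | succ k ih =>
    have hIζ : Measurable fun x : ℕ × ℕ → E d =>
        (simInfo x (simState q x k) k, simNoise x (simState q x k) k) :=
      measurable_simInfo_simNoise k ih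
    have hR : Measurable fun x : ℕ × ℕ → E d =>
        ((simState q x k).2 : Matrix (Fin d) (Fin d) ℝ) := measurable_subtype_coe.comp ih.snd
    have hv := measurable_mulv hR ((measurable_stepVec hq k).comp hIζ)
    have h1 := ((measurable_update' (a := k) (X := fun _ : ℕ => E d)).comp (ih.fst.prodMk hv)).prodMk
      (measurable_rot_mul ih.snd ((measurable_stepRot hq k).comp hIζ))
    exact h1

theorem measurable_simVec (hq : ∀ k, Measurable (q k)) (k : ℕ) :
    Measurable fun x : ℕ × ℕ → E d => simVec q x k := by
  simp only [← simState_fst (q := q) _ (Nat.lt_succ_self k)]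
  exact (measurable_pi_apply k).comp (measurable_simState hq (k + 1)).fst

theorem measurable_simRot (hq : ∀ k, Measurable (q k)) (k : ℕ) :
    Measurable fun x : ℕ × ℕ → E d => simRot q x k := by
  have := (measurable_stepRot hq k).comp (measurable_simInfo_simNoise k (measurable_simState hq k))
  exact this

/-- The block Krylov family `A ^ i * z j`. -/
noncomputable def krylov (A : Matrix (Fin d) (Fin d) ℝ) (z : ℕ → E d) : ℕ × ℕ → E d :=
  fun p => mulv (A ^ p.1) (z p.2)

/-- Applying `A ^ i` to a combination of Krylov vectors keeps the coefficients and shifts the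
powers, so the simulator needs no access to `A` itself. -/
theorem krylovApply_krylov (A : Matrix (Fin d) (Fin d) ℝ) (z : ℕ → E d) {j : ℕ} {v : E d}
    (hv : v ∈ Submodule.span ℝ (Set.range fun p : krylovIdx j => krylov A z p.1)) (i : ℕ) :
    krylovApply (krylov A z) j v i = mulv (A ^ i) v := by
  conv_rhs => rw [← proj_eq_self hv, proj, mulv_sum]
  refine Finset.sum_congr rfl fun c _ => ?_
  rw [mulv_smul, krylov, krylov, ← mulv_mul, ← pow_add, add_comm]

/-- The accumulated rotation after `k` steps of the simulation. -/
noncomputable def accRot (q : Queries d) (A : Matrix (Fin d) (Fin d) ℝ) (z : ℕ → E d) (k : ℕ) :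
    Matrix.specialOrthogonalGroup (Fin d) ℝ :=
  (simState q (krylov A z) k).2

/-- The matrix `A` rotated back after `k` steps of the simulation. -/
noncomputable def rotatedMat (q : Queries d) (A : Matrix (Fin d) (Fin d) ℝ) (z : ℕ → E d) (k : ℕ) :
    Matrix (Fin d) (Fin d) ℝ :=
  (accRot q A z k : Matrix (Fin d) (Fin d) ℝ).transpose * A *
    (accRot q A z k : Matrix (Fin d) (Fin d) ℝ)

/-- The vector `z k` rotated back by the accumulated rotation. -/
noncomputable def rotatedNoise (q : Queries d) (A : Matrix (Fin d) (Fin d) ℝ) (z : ℕ → E d)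
    (k : ℕ) : E d :=
  mulv (accRot q A z k : Matrix (Fin d) (Fin d) ℝ).transpose (z k)

theorem simNoise_krylov (A : Matrix (Fin d) (Fin d) ℝ) (z : ℕ → E d) (k : ℕ) :
    simNoise (krylov A z) (simState q (krylov A z) k) k = rotatedNoise q A z k := by
  simp [simNoise, krylov, rotatedNoise, accRot]

theorem rotatedMat_eq_orthConj (A : Matrix (Fin d) (Fin d) ℝ) (z : ℕ → E d) (k : ℕ) :
    rotatedMat q A z k = orthConj (toOrthogonal (accRot q A z k))⁻¹ A := by
  rw [orthConj, orthogonal_inv_val, Matrix.transpose_transpose]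
  rfl

theorem accRot_succ {A : Matrix (Fin d) (Fin d) ℝ} {z : ℕ → E d} {k : ℕ}
    (hI : simInfo (krylov A z) (simState q (krylov A z) k) k = info q (rotatedMat q A z k) k) :
    accRot q A z (k + 1) = accRot q A z k *
      stepRot q k (info q (rotatedMat q A z k) k) (rotatedNoise q A z k) := by
  rw [accRot, simState_snd_succ, simRot, hI, simNoise_krylov]
  rfl

theorem rotatedMat_succ {A : Matrix (Fin d) (Fin d) ℝ} {z : ℕ → E d} {k : ℕ}
    (hI : simInfo (krylov A z) (simState q (krylov A z) k) k = info q (rotatedMat q A z k) k) :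
    rotatedMat q A z (k + 1) = orthConj (toOrthogonal (stepRot q k
      (info q (rotatedMat q A z k) k) (rotatedNoise q A z k)))⁻¹ (rotatedMat q A z k) := by
  rw [rotatedMat_eq_orthConj A z (k + 1), accRot_succ hI]
  set T := stepRot q k (info q (rotatedMat q A z k) k) (rotatedNoise q A z k)
  rw [rotatedMat_eq_orthConj A z k, ← orthConj_mul, ← mul_inv_rev]
  rfl

/-- If the noise is generic, then the simulated queries, rotated back, are the queries on the
rotated matrix. -/
theorem mulv_transpose_simVec (A : Matrix (Fin d) (Fin d) ℝ) (z : ℕ → E d) (k : ℕ)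
    (h : ∀ j < k, IsGeneric q j (info q (rotatedMat q A z j) j) (rotatedNoise q A z j)) :
    (∀ j < k, mulv (accRot q A z k : Matrix (Fin d) (Fin d) ℝ).transpose (simVec q (krylov A z) j) =
      queryVec q (rotatedMat q A z k) j) ∧
    simInfo (krylov A z) (simState q (krylov A z) k) k = info q (rotatedMat q A z k) k := by
  -- Agreement of the queries suffices: the information then agrees because conjugation intertwines
  -- powers of `A` with those of the rotated matrix.
  have hinfo : ∀ k, (∀ j < k, mulv (accRot q A z k : Matrix (Fin d) (Fin d) ℝ).transpose
      (simVec q (krylov A z) j) = queryVec q (rotatedMat q A z k) j) →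
      simInfo (krylov A z) (simState q (krylov A z) k) k = info q (rotatedMat q A z k) k := by
    intro k hk
    funext p
    rw [simInfo, simState_fst _ p.2.2, krylovApply_krylov A z (simVec_mem_span _ _), info,
      ← hk _ p.2.2, rotatedMat_eq_orthConj, orthConj_pow]
    have := mulv_orthConj_smul (toOrthogonal (accRot q A z k))⁻¹ (A ^ p.1.1)
      (simVec q (krylov A z) p.1.2)
    exact this.symm
  suffices hmain : ∀ j < k, mulv (accRot q A z k : Matrix (Fin d) (Fin d) ℝ).transpose
      (simVec q (krylov A z) j) = queryVec q (rotatedMat q A z k) j from ⟨hmain, hinfo k hmain⟩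
  induction k with
  | zero => intro j hj; omega
  | succ k ih =>
    have ih := ih fun j hj => h j (hj.trans (Nat.lt_succ_self k))
    have hI := hinfo k ih
    have hg := h k (Nat.lt_succ_self k)
    have hacc := accRot_succ hI
    have hB' := rotatedMat_succ hI
    set B := rotatedMat q A z k
    set ζ := rotatedNoise q A z k
    set T := stepRot q k (info q B k) ζ
    have haccT : (accRot q A z (k + 1) : Matrix (Fin d) (Fin d) ℝ).transpose =
        (T : Matrix (Fin d) (Fin d) ℝ).transpose *
          (accRot q A z k : Matrix (Fin d) (Fin d) ℝ).transpose := by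
      rw [hacc, ← Matrix.transpose_mul]; rfl
    have hfix : (toOrthogonal T)⁻¹ • info q B k = info q B k := by
      rw [inv_smul_eq_iff, stepRot_smul]
    intro j hj
    rw [hB', queryVec_orthConj hfix (Nat.lt_succ_iff.1 hj), haccT, mulv_mul]
    rcases Nat.lt_succ_iff_lt_or_eq.1 hj with hj' | rfl
    · rw [ih j hj']
      exact smul_queryVec_of_smul_info hfix hj'
    -- The new query is the only place where genericity of step `k` is used: there `stepVec` is `T`
    -- applied to the true query, and `Tᵀ` undoes it.
    · rw [simVec, hI, simNoise_krylov, accRot, mulv_transpose_mulv_rot, ← mulv_stepRot hg,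
        mulv_transpose_mulv_rot, queryVec_eq]

theorem accRot_congr (A : Matrix (Fin d) (Fin d) ℝ) {z z' : ℕ → E d} {k : ℕ}
    (h : ∀ j < k, z j = z' j) : accRot q A z k = accRot q A z' k := by
  unfold accRot
  rw [simState_congr]
  intro p hp
  rw [krylov, krylov, h _ (by omega)]

end Simulator

/-! ### The law of the rotated matrix under Gaussian noise. -/

section Law

variable {d K : ℕ} {q : Queries d}

/-- Resampling one coordinate preserves a product of probability measures. -/
theorem measurePreserving_update {ι α : Type*} [Fintype ι] [DecidableEq ι] [MeasurableSpace α]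
    (γ : Measure α) [IsProbabilityMeasure γ] (k : ι) :
    MeasurePreserving (fun p : (ι → α) × α => Function.update p.1 k p.2)
      ((Measure.pi fun _ => γ).prod γ) (Measure.pi fun _ => γ) := by
  have hm : Measurable fun p : (ι → α) × α => Function.update p.1 k p.2 := measurable_update'
  refine ⟨hm, (Measure.pi_eq fun s hs => ?_).symm⟩
  rw [Measure.map_apply hm (MeasurableSet.univ_pi hs)]
  have : (fun p : (ι → α) × α => Function.update p.1 k p.2) ⁻¹' (Set.univ.pi s) =
      (Set.univ.pi (Function.update s k Set.univ)) ×ˢ s k := by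
    ext ⟨z, a⟩
    simp only [Set.mem_preimage, Set.mem_pi, Set.mem_univ, true_imp_iff, Set.mem_prod]
    constructor
    · refine fun h => ⟨fun i => ?_, by simpa using h k⟩
      by_cases hi : i = k
      · subst hi; simp
      · simpa [hi] using h i
    · rintro ⟨h1, h2⟩ i
      by_cases hi : i = k
      · subst hi; simpa using h2
      · simpa [hi] using h1 i
  rw [this, Measure.prod_prod, Measure.pi_pi, ← Finset.mul_prod_erase _ _ (Finset.mem_univ k),
    ← Finset.mul_prod_erase Finset.univ (fun i => γ (s i)) (Finset.mem_univ k),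
    Function.update_self, measure_univ, one_mul, mul_comm]
  congr 1
  refine Finset.prod_congr rfl fun i hi => ?_
  rw [Function.update_of_ne (Finset.ne_of_mem_erase hi)]

/-- Independent randomization by transformations that preserve the law preserves the law. -/
theorem lintegral_lintegral_of_map_eq {α β X : Type*} [MeasurableSpace α] [MeasurableSpace β]
    [MeasurableSpace X] {P : Measure α} [SFinite P] {γ : Measure β} [IsProbabilityMeasure γ]
    {ν : Measure X} {b : α → X} (hb : Measurable b) (hP : P.map b = ν) {Φ : β × X → X}
    (hΦ : Measurable Φ) (h : ∀ s, ν.map (fun x => Φ (s, x)) = ν) {f : X → ℝ≥0∞}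
    (hf : Measurable f) : ∫⁻ a, ∫⁻ s, f (Φ (s, b a)) ∂γ ∂P = ∫⁻ x, f x ∂ν := by
  rw [lintegral_lintegral_swap (f := fun a s => f (Φ (s, b a)))
    (hf.comp (hΦ.comp (measurable_snd.prodMk (hb.comp measurable_fst)))).aemeasurable]
  have h1 : ∀ s, ∫⁻ a, f (Φ (s, b a)) ∂P = ∫⁻ x, f x ∂ν := by
    intro s
    have hs : Measurable fun x => Φ (s, x) := hΦ.comp measurable_prodMk_left
    conv_rhs => rw [← h s]
    have hfs : Measurable fun x => f (Φ (s, x)) := hf.comp hs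
    rw [lintegral_map hf hs, ← hP, lintegral_map hfs hb]
  simp [h1]

theorem map_mulv_stdGaussian (g : Matrix.orthogonalGroup (Fin d) ℝ) :
    (stdGaussian (E d)).map (mulv (g : Matrix (Fin d) (Fin d) ℝ)) = stdGaussian (E d) := by
  let l : E d →ₗᵢ[ℝ] E d := ⟨Matrix.toEuclideanLin (g : Matrix (Fin d) (Fin d) ℝ),
    norm_mulv_orthogonal g⟩
  exact stdGaussian_map (l.toLinearIsometryEquiv rfl)

/-- Rewrites non-membership in a varying span as the non-vanishing of a measurable expression. -/
theorem isGeneric_iff {k : ℕ} (I : oracleIdx k → E d) (ζ : E d) :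
    IsGeneric q k I ζ ↔ perp (fun _ : Unit => perp I (q k I)) (perp I ζ) ≠ 0 := by
  rw [IsGeneric, not_iff_not]
  have hr : (Set.range fun _ : Unit => perp I (q k I)) = {perp I (q k I)} := Set.range_const
  constructor
  · intro h
    rw [perp, proj_eq_self (by rwa [hr]), sub_self]
  · intro h
    rw [← proj_add_perp (fun _ : Unit => perp I (q k I)) (perp I ζ), h, add_zero, ← hr]
    exact proj_mem_span _ _

theorem measurableSet_isGeneric (hq : ∀ k, Measurable (q k)) (k : ℕ) :
    MeasurableSet {p : (oracleIdx k → E d) × E d | IsGeneric q k p.1 p.2} := by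
  simp only [isGeneric_iff]
  have h1 : Measurable fun p : (oracleIdx k → E d) × E d => perp p.1 (q k p.1) :=
    measurable_perp.comp (measurable_fst.prodMk ((hq k).comp measurable_fst))
  have h2 : Measurable fun p : (oracleIdx k → E d) × E d =>
      ((fun _ : Unit => perp p.1 (q k p.1)), perp p.1 p.2) :=
    (measurable_pi_lambda _ fun _ => h1).prodMk measurable_perp
  exact (measurable_perp.comp h2) (measurableSet_singleton 0).compl

/-- Extension of a finite family of vectors by zero. -/
def zeroExtend (z : Fin K → E d) (j : ℕ) : E d := if h : j < K then z ⟨j, h⟩ else 0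

theorem measurable_zeroExtend : Measurable (zeroExtend (d := d) (K := K)) := by
  refine measurable_pi_lambda _ fun j => ?_
  unfold zeroExtend
  split_ifs <;> fun_prop

theorem zeroExtend_update (z : Fin K → E d) (k : Fin K) (s : E d) :
    zeroExtend (Function.update z k s) = Function.update (zeroExtend z) k s := by
  funext j
  by_cases hj : j = k
  · subst hj; simp [zeroExtend]
  · by_cases h : j < K
    · have : (⟨j, h⟩ : Fin K) ≠ k := fun e => hj (congrArg Fin.val e)
      simp [zeroExtend, hj, h, this]
    · simp [zeroExtend, hj, h]

/-- The data of the simulation: a matrix and Gaussian vectors. -/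
abbrev Input (d K : ℕ) : Type := Matrix (Fin d) (Fin d) ℝ × (Fin K → E d)

theorem measurable_krylov :
    Measurable fun p : Input d K => krylov p.1 (zeroExtend p.2) := by
  refine measurable_pi_lambda _ fun c => measurable_mulv_pow _ measurable_fst ?_
  exact (measurable_pi_apply c.2).comp (measurable_zeroExtend.comp measurable_snd)

theorem measurable_accRot (hq : ∀ k, Measurable (q k)) (k : ℕ) :
    Measurable fun p : Input d K => accRot q p.1 (zeroExtend p.2) k :=
  ((measurable_simState hq k).comp measurable_krylov).snd

theorem measurable_rotatedMat (hq : ∀ k, Measurable (q k)) (k : ℕ) :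
    Measurable fun p : Input d K => rotatedMat q p.1 (zeroExtend p.2) k := by
  have h : Measurable fun p : Input d K =>
      (accRot q p.1 (zeroExtend p.2) k : Matrix (Fin d) (Fin d) ℝ) :=
    measurable_subtype_coe.comp (measurable_accRot hq k)
  exact ((measurable_transpose.comp h).mul measurable_fst).mul h

theorem measurable_rotatedNoise (hq : ∀ k, Measurable (q k)) (k : ℕ) :
    Measurable fun p : Input d K => rotatedNoise q p.1 (zeroExtend p.2) k := by
  have h : Measurable fun p : Input d K =>
      (accRot q p.1 (zeroExtend p.2) k : Matrix (Fin d) (Fin d) ℝ) :=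
    measurable_subtype_coe.comp (measurable_accRot hq k)
  exact measurable_mulv (measurable_transpose.comp h)
    ((measurable_pi_apply k).comp (measurable_zeroExtend.comp measurable_snd))

theorem rotatedMat_congr (A : Matrix (Fin d) (Fin d) ℝ) {z z' : ℕ → E d} {k : ℕ}
    (h : ∀ j < k, z j = z' j) : rotatedMat q A z k = rotatedMat q A z' k := by
  rw [rotatedMat, accRot_congr A h, rotatedMat]

/-- The noise vectors before step `k` are generic. -/
def IsGenericBefore (q : Queries d) (p : Input d K) (k : ℕ) : Prop :=
  ∀ j < k, IsGeneric q j (info q (rotatedMat q p.1 (zeroExtend p.2) j) j)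
    (rotatedNoise q p.1 (zeroExtend p.2) j)

theorem zeroExtend_update_of_lt (z : Fin K → E d) (k : Fin K) (s : E d) {j : ℕ} (hj : j < k) :
    zeroExtend (Function.update z k s) j = zeroExtend z j := by
  rw [zeroExtend_update, Function.update_of_ne hj.ne]

theorem rotatedMat_update (A : Matrix (Fin d) (Fin d) ℝ) (z : Fin K → E d) (k : Fin K) (s : E d)
    {j : ℕ} (hj : j ≤ k) : rotatedMat q A (zeroExtend (Function.update z k s)) j =
      rotatedMat q A (zeroExtend z) j :=
  rotatedMat_congr A fun _ hi => zeroExtend_update_of_lt z k s (hi.trans_le hj)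

theorem rotatedNoise_update_self (A : Matrix (Fin d) (Fin d) ℝ) (z : Fin K → E d) (k : Fin K)
    (s : E d) : rotatedNoise q A (zeroExtend (Function.update z k s)) k =
      mulv ((toOrthogonal (accRot q A (zeroExtend z) k))⁻¹ :
        Matrix.orthogonalGroup (Fin d) ℝ) s := by
  rw [rotatedNoise, accRot_congr A fun i hi => zeroExtend_update_of_lt z k s hi, zeroExtend_update,
    Function.update_self]
  rfl

theorem isGenericBefore_update {A : Matrix (Fin d) (Fin d) ℝ} {z : Fin K → E d} {k : Fin K}
    (h : IsGenericBefore q (A, z) k) (s : E d) :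
    IsGenericBefore q (A, Function.update z k s) k := by
  intro j hj
  have h1 := h j hj
  dsimp only at h1 ⊢
  rw [rotatedMat_update A z k s hj.le, rotatedNoise,
    accRot_congr A fun i hi => zeroExtend_update_of_lt z k s (hi.trans hj),
    zeroExtend_update_of_lt z k s hj]
  exact h1

/-- The effect of step `k` on the matrix, as a function of the rotated noise. -/
noncomputable def stepMat (q : Queries d) (k : ℕ) (ζ : E d) (B : Matrix (Fin d) (Fin d) ℝ) :
    Matrix (Fin d) (Fin d) ℝ :=
  orthConj (toOrthogonal (stepRot q k (info q B k) ζ))⁻¹ B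

theorem measurable_stepMat (hq : ∀ k, Measurable (q k)) (k : ℕ) :
    Measurable fun p : E d × Matrix (Fin d) (Fin d) ℝ => stepMat q k p.1 p.2 := by
  have h1 : Measurable fun p : E d × Matrix (Fin d) (Fin d) ℝ =>
      stepRot q k (info q p.2 k) p.1 :=
    (measurable_stepRot hq k).comp (((measurable_info hq k).comp measurable_snd).prodMk
      measurable_fst)
  have h2 := measurable_orthConj.comp
    (measurable_snd.prodMk (measurable_toOrthogonal.comp h1).inv)
  exact h2

theorem measurable_stepMat_left (hq : ∀ k, Measurable (q k)) (k : ℕ)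
    (B : Matrix (Fin d) (Fin d) ℝ) : Measurable fun ζ => stepMat q k ζ B := by
  have := (measurable_stepMat hq k).comp (measurable_id.prodMk (measurable_const (a := B)))
  exact this

theorem map_stepMat (hq : ∀ k, Measurable (q k)) {ν : Measure (Matrix (Fin d) (Fin d) ℝ)}
    [SFinite ν] (hν : ∀ g, ν.map (orthConj g) = ν) (k : ℕ) (ζ : E d) :
    ν.map (stepMat q k ζ) = ν := by
  refine map_orthConj_info hq hν k
    (Ψ := fun I => (toOrthogonal (stepRot q k I ζ))⁻¹) ?_ fun I => ?_
  · exact (measurable_toOrthogonal.comp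
      ((measurable_stepRot hq k).comp (measurable_id.prodMk measurable_const))).inv
  · rw [inv_smul_eq_iff, stepRot_smul]

/-- The rotated matrix has the law of the original one, and the noise is almost surely generic. -/
theorem ae_isGenericBefore_and_map_rotatedMat (hq : ∀ k, Measurable (q k)) (hK : K ^ 2 < d)
    {ν : Measure (Matrix (Fin d) (Fin d) ℝ)} [IsProbabilityMeasure ν]
    (hν : ∀ g, ν.map (orthConj g) = ν) (k : ℕ) (hk : k ≤ K) :
    (∀ᵐ p ∂(ν.prod (Measure.pi fun _ : Fin K => stdGaussian (E d))), IsGenericBefore q p k) ∧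
    (ν.prod (Measure.pi fun _ : Fin K => stdGaussian (E d))).map
      (fun p => rotatedMat q p.1 (zeroExtend p.2) k) = ν := by
  set γ := stdGaussian (E d) with hγ
  set π := Measure.pi fun _ : Fin K => γ
  induction k with
  | zero =>
    refine ⟨Eventually.of_forall fun p j hj => absurd hj (Nat.not_lt_zero j), ?_⟩
    have : (fun p : Input d K => rotatedMat q p.1 (zeroExtend p.2) 0) = Prod.fst := by
      funext p
      simp [rotatedMat, accRot, simState]
    rw [this, Measure.map_fst_prod, measure_univ, one_smul]
  | succ k ih =>
    obtain ⟨ihg, ihl⟩ := ih (Nat.le_of_succ_le hk)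
    let κ : Fin K := ⟨k, hk⟩
    -- Replacing `z_k` by a fresh Gaussian preserves the joint law and exposes its independence from
    -- `A` and the earlier noise, on which the rotation and matrix after `k` steps depend.
    let φ : Input d K × E d → Input d K := fun p => (p.1.1, Function.update p.1.2 κ p.2)
    have hφ : MeasurePreserving φ ((ν.prod π).prod γ) (ν.prod π) :=
      ((MeasurePreserving.id ν).prod (measurePreserving_update γ κ)).comp
        (measurePreserving_prodAssoc ν π γ)
    have hBm := measurable_rotatedMat (K := K) hq k
    have hζm := measurable_rotatedNoise (K := K) hq k
    have hrot : ∀ p : Input d K, (fun s => rotatedNoise q (φ (p, s)).1 (zeroExtend (φ (p, s)).2) k) =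
        mulv ((toOrthogonal (accRot q p.1 (zeroExtend p.2) k))⁻¹ :
        Matrix.orthogonalGroup (Fin d) ℝ) := fun p =>
      funext fun s => rotatedNoise_update_self p.1 p.2 κ s
    have hmul : ∀ g : Matrix.orthogonalGroup (Fin d) ℝ,
        Measurable (mulv (g : Matrix (Fin d) (Fin d) ℝ)) := fun g =>
      measurable_mulv measurable_const measurable_id
    constructor
    · have hS : MeasurableSet {p : Input d K | IsGeneric q k
          (info q (rotatedMat q p.1 (zeroExtend p.2) k) k)
          (rotatedNoise q p.1 (zeroExtend p.2) k)} :=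
        (((measurable_info hq k).comp hBm).prodMk hζm) (measurableSet_isGeneric hq k)
      have hae : ∀ᵐ p ∂(ν.prod π), IsGeneric q k (info q (rotatedMat q p.1 (zeroExtend p.2) k) k)
          (rotatedNoise q p.1 (zeroExtend p.2) k) := by
        rw [← hφ.map_eq, ae_map_iff hφ.measurable.aemeasurable hS,
          Measure.ae_prod_iff_ae_ae (p := fun x => IsGeneric q k
            (info q (rotatedMat q (φ x).1 (zeroExtend (φ x).2) k) k)
            (rotatedNoise q (φ x).1 (zeroExtend (φ x).2) k)) (hφ.measurable hS)]
        refine Eventually.of_forall fun p => ?_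
        have h1 := ae_isGeneric (q := q) (lt_of_le_of_lt (Nat.pow_le_pow_left hk 2) hK)
          (info q (rotatedMat q p.1 (zeroExtend p.2) k) k)
        rw [← map_mulv_stdGaussian (toOrthogonal (accRot q p.1 (zeroExtend p.2) k))⁻¹] at h1
        have h2 := ae_of_ae_map (hmul _).aemeasurable h1
        filter_upwards [h2] with s hs
        rw [← hrot p] at hs
        rw [show rotatedMat q (φ (p, s)).1 (zeroExtend (φ (p, s)).2) k =
          rotatedMat q p.1 (zeroExtend p.2) k from rotatedMat_update p.1 p.2 κ s le_rfl]
        exact hs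
      filter_upwards [ihg, hae] with p h1 h2 j hj
      rcases Nat.lt_succ_iff_lt_or_eq.1 hj with h | rfl
      · exact h1 j h
      · exact h2
    · have hB1 := measurable_rotatedMat (K := K) hq (k + 1)
      ext t ht
      rw [← lintegral_indicator_one ht, ← lintegral_indicator_one ht]
      have hf : Measurable (t.indicator (1 : Matrix (Fin d) (Fin d) ℝ → ℝ≥0∞)) :=
        measurable_one.indicator ht
      generalize t.indicator (1 : Matrix (Fin d) (Fin d) ℝ → ℝ≥0∞) = f at hf
      rw [lintegral_map hf hB1]
      calc ∫⁻ p, f (rotatedMat q p.1 (zeroExtend p.2) (k + 1)) ∂(ν.prod π)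
          = ∫⁻ p, ∫⁻ s, f (rotatedMat q (φ (p, s)).1 (zeroExtend (φ (p, s)).2) (k + 1)) ∂γ
              ∂(ν.prod π) := by
            have h1 : Measurable fun p : Input d K =>
              f (rotatedMat q p.1 (zeroExtend p.2) (k + 1)) := hf.comp hB1
            have h2 := h1.comp hφ.measurable
            rw [← hφ.lintegral_comp h1]
            exact lintegral_prod _ h2.aemeasurable
        _ = ∫⁻ p, ∫⁻ s, f (stepMat q k s (rotatedMat q p.1 (zeroExtend p.2) k)) ∂γ
              ∂(ν.prod π) := by
            refine lintegral_congr_ae ?_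
            filter_upwards [ihg] with p hp
            have h1 : Measurable fun s => f (stepMat q k s (rotatedMat q p.1 (zeroExtend p.2) k)) :=
              hf.comp (measurable_stepMat_left hq k _)
            -- For fixed `p`, rotating the fresh noise back by the accumulated rotation does not
            -- change its Gaussian law.
            conv_rhs => rw [hγ, ← map_mulv_stdGaussian
              (toOrthogonal (accRot q p.1 (zeroExtend p.2) k))⁻¹]
            rw [lintegral_map h1 (hmul _), ← hrot p]
            refine lintegral_congr fun s => ?_
            have h2 := isGenericBefore_update (k := κ) hp s
            rw [rotatedMat_succ (mulv_transpose_simVec _ _ k h2).2,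
              show rotatedMat q (φ (p, s)).1 (zeroExtend (φ (p, s)).2) k =
              rotatedMat q p.1 (zeroExtend p.2) k from rotatedMat_update p.1 p.2 κ s le_rfl]
            rfl
        _ = ∫⁻ B, f B ∂ν :=
            -- For every fixed `s`, the step conjugates by a stabilizer element chosen from the
            -- information, hence preserves `ν`.
            lintegral_lintegral_of_map_eq hBm ihl
              (Φ := fun x : E d × Matrix (Fin d) (Fin d) ℝ => stepMat q k x.1 x.2)
              (measurable_stepMat hq k) (map_stepMat hq hν k) hf

theorem measurable_conjDiag : Measurable fun p : Matrix.orthogonalGroup (Fin d) ℝ × (Fin d → ℝ) =>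
    conjDiag p.1 p.2 := by
  refine Continuous.measurable ?_
  unfold conjDiag
  fun_prop

theorem orthConj_conjDiag (g U : Matrix.orthogonalGroup (Fin d) ℝ) (D : Fin d → ℝ) :
    orthConj g (conjDiag U D) = conjDiag (U * g⁻¹) D := by
  simp only [orthConj, conjDiag, Matrix.UnitaryGroup.mul_val, orthogonal_inv_val,
    Matrix.transpose_mul, Matrix.transpose_transpose, Matrix.mul_assoc]

/-- The law of `Uᵀ D U` is invariant under conjugation. -/
theorem map_orthConj_conjDiag {Ω : Type*} [MeasurableSpace Ω] {μ : Measure Ω}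
    [IsProbabilityMeasure μ] {U : Ω → Matrix.orthogonalGroup (Fin d) ℝ} {D : Ω → Fin d → ℝ}
    (hU : IsHaarRandom U μ) (hD : Measurable D) (hUD : IndepFun U D μ)
    (g : Matrix.orthogonalGroup (Fin d) ℝ) :
    (μ.map fun ω => conjDiag (U ω) (D ω)).map (orthConj g) =
      μ.map fun ω => conjDiag (U ω) (D ω) := by
  have := hU.2
  have : IsProbabilityMeasure (μ.map U) := Measure.isProbabilityMeasure_map hU.1.aemeasurable
  have : IsProbabilityMeasure (μ.map D) := Measure.isProbabilityMeasure_map hD.aemeasurable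
  have := isMulRightInvariant_of_isHaarMeasure (μ.map U)
  have hlaw := (indepFun_iff_map_prod_eq_prod_map_map hU.1.aemeasurable hD.aemeasurable).1 hUD
  have hm : (μ.map fun ω => conjDiag (U ω) (D ω)) =
      ((μ.map U).prod (μ.map D)).map fun p => conjDiag p.1 p.2 := by
    rw [← hlaw, Measure.map_map measurable_conjDiag (hU.1.prodMk hD)]
    rfl
  have hg : Measurable (orthConj g) := by
    have := measurable_orthConj.comp (measurable_id.prodMk (measurable_const (a := g)))
    exact this
  have hp := (measurePreserving_mul_right (μ.map U) g⁻¹).prod (MeasurePreserving.id (μ.map D))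
  rw [hm, Measure.map_map hg measurable_conjDiag]
  conv_rhs => rw [← hp.map_eq]
  rw [Measure.map_map measurable_conjDiag hp.measurable]
  congr 1
  funext p
  exact orthConj_conjDiag g p.1 p.2

end Law

/-! ### Passage to algorithms with finitely many queries, and the theorem. -/

section Main

variable {d K : ℕ}

/-- The queries of an algorithm, continued by zero after the last query. -/
noncomputable def AdaptiveAlgorithm.queries (alg : AdaptiveAlgorithm d K) : Queries d :=
  fun k I => if h : k < K then alg.query ⟨k, h⟩ I else 0

theorem AdaptiveAlgorithm.measurable_queries (alg : AdaptiveAlgorithm d K) (k : ℕ) :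
    Measurable (alg.queries k) := by
  unfold AdaptiveAlgorithm.queries
  split_ifs with h
  · exact alg.measurable_query ⟨k, h⟩
  · exact measurable_const

theorem AdaptiveAlgorithm.run_eq (alg : AdaptiveAlgorithm d K) (A : Matrix (Fin d) (Fin d) ℝ)
    (k : Fin K) : alg.run A k = queryVec alg.queries A k := by
  obtain ⟨k, hk⟩ := k
  induction k using Nat.strong_induction_on with
  | _ k ih =>
    rw [AdaptiveAlgorithm.run, queryVec_eq, AdaptiveAlgorithm.queries, dif_pos hk]
    congr 1
    funext p
    rw [ih p.1.2 p.2.2]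
    rfl

open Classical in
/-- Extension by zero of block Krylov data. -/
noncomputable def krylovExtend (k : ℕ) (x : krylovIdx k → E d) (p : ℕ × ℕ) : E d :=
  if h : p ∈ krylovIdx k then x ⟨p, h⟩ else 0

theorem measurable_krylovExtend (k : ℕ) : Measurable (krylovExtend (d := d) k) := by
  refine measurable_pi_lambda _ fun p => ?_
  unfold krylovExtend
  split_ifs <;> fun_prop

theorem krylovExtend_krylovData (A : Matrix (Fin d) (Fin d) ℝ) (z : Fin K → E d) (k : Fin K) :
    ∀ p ∈ krylovIdx k, krylovExtend k (krylovData A z k) p = krylov A (zeroExtend z) p := by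
  intro p hp
  have h2 : p.2 < K := ((Nat.le_add_left _ _).trans hp).trans_lt k.2
  rw [krylovExtend, dif_pos hp, krylov, zeroExtend, dif_pos h2]
  rfl

end Main

end BlockKrylov

theorem mainTheorem4 (d K : ℕ) (hK : K ^ 2 < d) (alg : AdaptiveAlgorithm d K) :
    ∃ (vsim : (k : Fin K) → (krylovIdx k → E d) → E d)
      (Usim : (k : Fin K) → (krylovIdx k → E d) → Matrix.specialOrthogonalGroup (Fin d) ℝ),
      (∀ k, Measurable (vsim k)) ∧ (∀ k, Measurable (Usim k)) ∧
      (∀ k x, vsim k x ∈ Submodule.span ℝ (Set.range x)) ∧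
      ∀ (Ω : Type*) [MeasurableSpace Ω] (μ : Measure Ω) [IsProbabilityMeasure μ]
        (U : Ω → Matrix.orthogonalGroup (Fin d) ℝ) (D : Ω → Fin d → ℝ) (z : Fin K → Ω → E d)
        (A : Ω → Matrix (Fin d) (Fin d) ℝ) (v : Fin K → Ω → E d)
        (R : Fin K → Ω → Matrix.specialOrthogonalGroup (Fin d) ℝ),
        IsHaarRandom U μ → Measurable D → IndepFun U D μ →
        (∀ j, Measurable (z j)) → (∀ j, μ.map (z j) = stdGaussian (E d)) → iIndepFun z μ →
        IndepFun (fun ω => (U ω, D ω)) (fun ω j => z j ω) μ →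
        (∀ ω, A ω = conjDiag (U ω) (D ω)) →
        (∀ k ω, v k ω = vsim k (krylovData (A ω) (fun j => z j ω) k)) →
        (∀ k ω, R k ω = Usim k (krylovData (A ω) (fun j => z j ω) k)) →
        (∀ k, (∀ᵐ ω ∂μ, ‖alg.run (A ω) k‖ = 1) → ∀ᵐ ω ∂μ, ‖v k ω‖ = 1) ∧
        IdentDistrib
          (fun ω =>
            ((rotProd fun k => R k ω).transpose * A ω * (rotProd fun k => R k ω),
              fun p => mulv (rotProd fun k => R k ω).transpose
                (oracleInfo (A ω) (fun k => v k ω) p)))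
          (fun ω => (A ω, oracleInfo (A ω) (fun k => alg.run (A ω) k)))
          μ μ := by
  set q := alg.queries with hqdef
  have hq : ∀ k, Measurable (q k) := alg.measurable_queries
  refine ⟨fun k x => simVec q (krylovExtend k x) k, fun k x => simRot q (krylovExtend k x) k,
    fun k => (measurable_simVec hq k).comp (measurable_krylovExtend k),
    fun k => (measurable_simRot hq k).comp (measurable_krylovExtend k), fun k x => ?_, ?_⟩
  · convert simVec_mem_span (q := q) (krylovExtend k x) k using 3
    funext p
    rw [krylovExtend, dif_pos p.2]
  intro Ω _ μ _ U D z A v R hU hD hUD hz hzlaw hzind hind hA hv hR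
  obtain rfl : A = fun ω => conjDiag (U ω) (D ω) := funext hA
  set A : Ω → Matrix (Fin d) (Fin d) ℝ := fun ω => conjDiag (U ω) (D ω) with hAdef
  have hAm : Measurable A := by
    have := measurable_conjDiag.comp (hU.1.prodMk hD)
    exact this
  set Z : Ω → Fin K → E d := fun ω j => z j ω
  have hZm : Measurable Z := measurable_pi_lambda _ hz
  set ν := μ.map A with hνdef
  have : IsProbabilityMeasure ν := Measure.isProbabilityMeasure_map hAm.aemeasurable
  have hν : ∀ g, ν.map (orthConj g) = ν := map_orthConj_conjDiag hU hD hUD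
  have hZlaw : μ.map Z = Measure.pi fun _ => stdGaussian (E d) := by
    rw [(iIndepFun_iff_map_fun_eq_pi_map fun j => (hz j).aemeasurable).1 hzind]
    simp only [hzlaw]
  have hAZ : IndepFun A Z μ := by
    have := hind.comp measurable_conjDiag measurable_id
    exact this
  have hlaw : μ.map (fun ω => (A ω, Z ω)) =
      ν.prod (Measure.pi fun _ : Fin K => stdGaussian (E d)) := by
    rw [(indepFun_iff_map_prod_eq_prod_map_map hAm.aemeasurable hZm.aemeasurable).1 hAZ, hZlaw]
  obtain ⟨hgen, hB⟩ := ae_isGenericBefore_and_map_rotatedMat (K := K) hq hK hν K le_rfl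
  rw [← hlaw] at hgen hB
  have hgen := ae_of_ae_map (hAm.prodMk hZm).aemeasurable hgen
  rw [Measure.map_map (measurable_rotatedMat hq K) (hAm.prodMk hZm)] at hB
  set B : Ω → Matrix (Fin d) (Fin d) ℝ := fun ω => rotatedMat q (A ω) (zeroExtend (Z ω)) K
  have hBm : Measurable B := by
    have := (measurable_rotatedMat hq K).comp (hAm.prodMk hZm)
    exact this
  have hB : μ.map B = ν := hB
  have hv' : ∀ k ω, v k ω = simVec q (krylov (A ω) (zeroExtend (Z ω))) k := fun k ω => by
    rw [hv]
    exact simVec_congr (krylovExtend_krylovData _ _ k)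
  have hR' : ∀ k ω, R k ω = simRot q (krylov (A ω) (zeroExtend (Z ω))) k := fun k ω => by
    rw [hR]
    exact simRot_congr (krylovExtend_krylovData _ _ k)
  have hprod : ∀ ω, (rotProd fun k => R k ω) =
      (accRot q (A ω) (zeroExtend (Z ω)) K : Matrix (Fin d) (Fin d) ℝ) := fun ω => by
    simp only [rotProd, hR']
    rw [accRot, simState_snd_eq_prod]
  -- A single rotation, the full product, takes all simulated queries to the queries on `B`; both
  -- remaining claims follow because `B` has the law of `A`.
  have hrun : ∀ᵐ ω ∂μ, ∀ k : Fin K,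
      mulv (rotProd fun k => R k ω).transpose (v k ω) = alg.run (B ω) k := by
    filter_upwards [hgen] with ω hω k
    rw [hprod, hv', alg.run_eq]
    exact (mulv_transpose_simVec _ _ K hω).1 k k.2
  have hrunm : ∀ k, Measurable fun A => alg.run A k := fun k => by
    simp only [alg.run_eq]
    exact measurable_queryVec hq k
  constructor
  · intro k hk
    have hS : MeasurableSet {A | ‖alg.run A k‖ = 1} :=
      (hrunm k).norm (measurableSet_singleton 1)
    have h1 : ∀ᵐ C ∂ν, ‖alg.run C k‖ = 1 := (ae_map_iff hAm.aemeasurable hS).2 hk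
    rw [← hB] at h1
    filter_upwards [ae_of_ae_map hBm.aemeasurable h1, hrun] with ω h2 h3
    rw [← h2, ← h3 k, hprod]
    exact (norm_mulv_orthogonal (toOrthogonal (accRot q (A ω) (zeroExtend (Z ω)) K))⁻¹ _).symm
  · set G : Matrix (Fin d) (Fin d) ℝ → Matrix (Fin d) (Fin d) ℝ × (oracleIdx K → E d) :=
      fun C => (C, oracleInfo C fun k => alg.run C k)
    have hGm : Measurable G := by
      have h1 : Measurable fun C => oracleInfo C fun k => alg.run C k :=
        measurable_pi_lambda _ fun p => measurable_mulv_pow _ measurable_id (hrunm _)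
      exact measurable_id.prodMk h1
    -- The rotated pair is almost surely the same measurable function `G` of `B` as the target pair
    -- is of `A`.
    have hae : (fun ω => ((rotProd fun k => R k ω).transpose * A ω * (rotProd fun k => R k ω),
        fun p => mulv (rotProd fun k => R k ω).transpose
          (oracleInfo (A ω) (fun k => v k ω) p))) =ᵐ[μ] G ∘ B := by
      filter_upwards [hrun] with ω hω
      refine Prod.ext ?_ ?_
      · simp only [hprod]
        rfl
      · funext p
        simp only [G, Function.comp, oracleInfo]
        rw [← hω, hprod]
        change _ = mulv (rotatedMat q (A ω) (zeroExtend (Z ω)) K ^ p.1.1) _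
        rw [rotatedMat_eq_orthConj, orthConj_pow]
        exact (mulv_orthConj_smul (toOrthogonal (accRot q (A ω) (zeroExtend (Z ω)) K))⁻¹ _ _).symm
    refine ⟨⟨G ∘ B, hGm.comp hBm, hae⟩, (hGm.comp hAm).aemeasurable, ?_⟩
    rw [Measure.map_congr hae, ← Measure.map_map hGm hBm, hB, hνdef, Measure.map_map hGm hAm]
    rfl
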